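/- **Setting.** Consider polarized SILL, a language of session-typed processes with a functional layer. Functional types are function types $\tau\to\sigma$ and types $\{a:A\leftarrow\overline{a_i:A_i}\}$ of quoted processes; functional terms are variables, $\lambda$-abstractions, applications, fixed points and quoted processes. Session types are positive ($\mathbf 1$, $\downarrow A$, $\oplus\{l:A_l\}_{l\in L}$, $B\otimes A$, $\tau\wedge A$) or negative ($\uparrow A$, $\&\{l:A_l\}_{l\in L}$, $B\multimap A$, $\tau\supset A$), with type variables and recursive types $\rho\alpha.A$ of both polarities and finite label sets $L$. The judgment $\Psi;\Delta\vdash P::c:C$ says that the process $P$, with free functional variables $\Psi$, uses the channels $\Delta$ and provides the channel $c$ of type $C$; all channel names declared in $\Delta,\,c:C$ are distinct. A session type $A$ denotes two pointed dcpos, its negative aspect $[\![A]\!]^-$ and its positive aspect $[\![A]\!]^+$; in particular $$[\![\oplus\{l:A_l\}_{l\in L}]\!]^-=\prod_{l\in L}[\![A_l]\!]^-,\qquad [\![\oplus\{l:A_l\}_{l\in L}]\!]^+=\bigoplus_{l\in L}\bigl([\![A_l]\!]^+\bigr)_\bot ,$$ where $\bigoplus$ is the coalesced sum and $(\cdot)_\bot$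 is lifting, with unit $d\mapsto[d]$. Recursive types denote canonical solutions of domain equations. A process denotes a Scott-continuous function $$[\![\Psi;\Delta\vdash P::c:C]\!] : [\![\Psi]\!]\to\bigl[[\![\Delta]\!]^+\times[\![C]\!]^-\to[\![\Delta]\!]^-\times[\![C]\!]^+\bigr],$$ defined by recursion on its typing derivation. Two processes with the same typing are *equivalent*, $P\equiv Q$, if their denotations are equal. The clauses relevant below are the following, for $u\in[\![\Psi]\!]$. * *Composition.* If $\Psi;\Delta_1\vdash P::a:A$ and $\Psi;a:A,\Delta_2\vdash Q::c:C$, then $\Psi;\Delta_1,\Delta_2\vdash (a\leftarrow P;Q)::c:C$, and $[\![a\leftarrow P;Q]\!]u$ sends $(\delta_1^+,\delta_2^+,c^-)$ to the components $(\delta_1^-,\delta_2^-,c^+)$ of the least solution of $$(\delta_1^-,a^+)=[\![P]\!]u(\delta_1^+,a^-),\qquad(\delta_2^-,a^-,c^+)=[\![Q]\!]u(\delta_2^+,a^+,c^-).$$ (This is the trace over $[\![A]\!]^-\times[\![A]\!]^+$ of the product of the two functions.) * *Sending a label.* If $k\in L$ and $\Psi;\Delta\vdash P::a:A_k$, then $\Psi;\Delta\vdash(a.k;P)::a:\oplus\{l:A_l\}_{l\in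 L}$, and $$[\![a.k;P]\!]u\bigl(\delta^+,(a_l^-)_{l\in L}\bigr)=\bigl(\delta^-,(k,[a_k^+])\bigr),\quad\text{where }(\delta^-,a_k^+)=[\![P]\!]u(\delta^+,a_k^-).$$ * *Case analysis.* If $\Psi;a:A_l,\Delta\vdash Q_l::c:C$ for all $l\in L$, then $\Psi;a:\oplus\{l:A_l\}_{l\in L},\Delta\vdash\mathsf{case}\;a\;\{l\Rightarrow Q_l\}_{l\in L}::c:C$. Its denotation at $u$ sends $(\delta^+,\bot,c^-)$ to $\bot$, and sends $(\delta^+,(k,[a_k^+]),c^-)$ to $(\delta^-,a^-,c^+)$, where $(\delta^-,a_k^-,c^+)=[\![Q_k]\!]u(\delta^+,a_k^+,c^-)$ and $a^-\in\prod_{l\in L}[\![A_l]\!]^-$ has $k$-th component $a_k^-$ and all other components $\bot$. **Proposition.** Let $L$ be a finite set of labels, let $A_l$ be a closed positive session type for each $l\in L$, and let $k\in L$. If $\Psi;\Delta_1\vdash P::a:A_k$, and $\Psi;a:A_l,\Delta_2\vdash Q_l::c:C$ for all $l\in L$, where the channel names declared in $\Delta_1,\Delta_2$, together with $a$ and $c$,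 are pairwise distinct, then $$(a\leftarrow P;\;Q_k)\;\equiv\;\bigl(a\leftarrow (a.k;P);\;\mathsf{case}\;a\;\{l\Rightarrow Q_l\}_{l\in L}\bigr).$$ -/

import Mathlib

namespace SILL

open CategoryTheory

noncomputable section

/-! ### Pointed dcpos and Scott-continuous functions

Mathlib's `CompletePartialOrder` is the class of pointed dcpos: partial orders in which every
directed set, the empty one included, has a least upper bound. -/

/-- A dcpo structure from the mere existence of least upper bounds of directed sets. -/
@[reducible]
def dcpoOf (D : Type) [PartialOrder D] [OrderBot D]
    (h : ∀ s : Set D, s.Nonempty → DirectedOn (· ≤ ·) s → ∃ x, IsLUB s x) :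
    CompletePartialOrder D where
  sSup s := open Classical in if hs : ∃ x, IsLUB s x then hs.choose else ⊥
  bot_le := fun _ => bot_le
  lubOfDirected s hs := by
    have hx : ∃ x, IsLUB s x := by
      rcases s.eq_empty_or_nonempty with rfl | hne
      · exact ⟨⊥, isLUB_empty⟩
      · exact h s hne hs
    simp only [hx, dif_pos]
    exact hx.choose_spec

instance (D E : Type) [CompletePartialOrder D] [CompletePartialOrder E] :
    CompletePartialOrder (D × E) :=
  dcpoOf _ fun s _ hs => by
    have h1 : DirectedOn (· ≤ ·) (Prod.fst '' s) := hs.mono_comp (fun _ _ h => h.1)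
    have h2 : DirectedOn (· ≤ ·) (Prod.snd '' s) := hs.mono_comp (fun _ _ h => h.2)
    exact ⟨(sSup (Prod.fst '' s), sSup (Prod.snd '' s)),
      isLUB_prod.2 ⟨h1.isLUB_sSup, h2.isLUB_sSup⟩⟩

instance {I : Type} (D : I → Type) [∀ i, CompletePartialOrder (D i)] :
    CompletePartialOrder (∀ i, D i) :=
  dcpoOf _ fun s _ hs => by
    have h1 (i : I) : DirectedOn (· ≤ ·) (Function.eval i '' s) := hs.mono_comp (fun _ _ h => h i)
    exact ⟨fun i => sSup (Function.eval i '' s), isLUB_pi.2 fun i => (h1 i).isLUB_sSup⟩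

instance : CompletePartialOrder Unit where
  sSup _ := ()
  bot_le _ := le_rfl
  lubOfDirected _ _ := ⟨fun _ _ => le_rfl, fun _ _ => le_rfl⟩

/-- Scott-continuous functions `D → E`: the hom-sets of the category of pointed dcpos. -/
structure Cont (D E : Type) [CompletePartialOrder D] [CompletePartialOrder E] where
  toFun : D → E
  cont' : ScottContinuous toFun

section Cont

variable {A B D E : Type} [CompletePartialOrder A] [CompletePartialOrder B]
  [CompletePartialOrder D] [CompletePartialOrder E]

instance : FunLike (Cont D E) D E where
  coe := Cont.toFun
  coe_injective := by rintro ⟨f, _⟩ ⟨g, _⟩ h; cases h; rfl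

@[ext] theorem Cont.ext {f g : Cont D E} (h : ∀ x, f x = g x) : f = g := DFunLike.ext _ _ h

@[fun_prop] theorem Cont.cont (f : Cont D E) : ScottContinuous f := f.cont'

theorem Cont.mono (f : Cont D E) : Monotone f := f.cont.monotone

/-- Continuous functions are ordered pointwise. -/
instance : PartialOrder (Cont D E) := PartialOrder.lift (fun f => (f : D → E)) DFunLike.coe_injective

theorem Cont.le_def {f g : Cont D E} : f ≤ g ↔ ∀ x, f x ≤ g x := Iff.rfl

instance : OrderBot (Cont D E) where
  bot := ⟨fun _ => ⊥, ScottContinuous.const _⟩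
  bot_le _ _ := bot_le

theorem scottContinuous_iSup {S : Set (Cont D E)} {g : D → E}
    (hg : ∀ x, IsLUB ((fun f : Cont D E => f x) '' S) (g x)) : ScottContinuous g := by
  intro d hne hd a ha
  constructor
  · rintro _ ⟨x, hx, rfl⟩
    refine (hg x).2 ?_
    rintro _ ⟨f, hf, rfl⟩
    exact (f.mono (ha.1 hx)).trans ((hg a).1 ⟨f, hf, rfl⟩)
  · intro b hb
    refine (hg a).2 ?_
    rintro _ ⟨f, hf, rfl⟩
    refine (f.cont hne hd ha).2 ?_
    rintro _ ⟨x, hx, rfl⟩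
    exact ((hg x).1 ⟨f, hf, rfl⟩).trans (hb ⟨x, hx, rfl⟩)

theorem Cont.directed_apply {S : Set (Cont D E)} (hS : DirectedOn (· ≤ ·) S) (x : D) :
    DirectedOn (· ≤ ·) ((fun f : Cont D E => f x) '' S) := hS.mono_comp (fun _ _ h => h x)

theorem Cont.isLUB_of {S : Set (Cont D E)} {g : Cont D E}
    (hg : ∀ x, IsLUB ((fun f : Cont D E => f x) '' S) (g x)) : IsLUB S g :=
  ⟨fun f hf x => (hg x).1 ⟨f, hf, rfl⟩,
   fun _ hb x => (hg x).2 (by rintro _ ⟨f, hf, rfl⟩; exact hb hf x)⟩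

instance : CompletePartialOrder (Cont D E) :=
  dcpoOf _ fun S _ hS => ⟨⟨fun x => sSup ((fun f : Cont D E => f x) '' S),
    scottContinuous_iSup (S := S) fun x => (Cont.directed_apply hS x).isLUB_sSup⟩,
    Cont.isLUB_of fun x => (Cont.directed_apply hS x).isLUB_sSup⟩

theorem Cont.isLUB_apply {S : Set (Cont D E)} (hS : DirectedOn (· ≤ ·) S) {g : Cont D E}
    (hg : IsLUB S g) (x : D) : IsLUB ((fun f : Cont D E => f x) '' S) (g x) := by
  have h := fun x => (Cont.directed_apply hS x).isLUB_sSup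
  have := hg.unique (Cont.isLUB_of (g := ⟨_, scottContinuous_iSup h⟩) h)
  rw [this]
  exact h x

def Cont.comp (g : Cont D E) (f : Cont A D) : Cont A E := ⟨fun x => g (f x), by fun_prop⟩

/-- Currying `Λ`. -/
def Cont.curry (f : Cont (A × D) E) : Cont A (Cont D E) where
  toFun a := ⟨fun d => f (a, d), by fun_prop⟩
  cont' := fun _ hne hd a ha => Cont.isLUB_of fun x => by
    have h : ScottContinuous (fun a => f (a, x)) := by fun_prop
    have := h hne hd ha
    rw [Set.image_image]
    exact this

theorem scottContinuous_eval : ScottContinuous (fun p : Cont D E × D => p.1 p.2) :=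
  ScottContinuous.fromProd (fun f => f.cont) fun x _ _ hS _ hg => Cont.isLUB_apply hS hg x

/-- Evaluation is jointly continuous. -/
@[fun_prop] theorem ScottContinuous.apply {f : A → Cont D E} {g : A → D}
    (hf : ScottContinuous f) (hg : ScottContinuous g) : ScottContinuous (fun a => f a (g a)) :=
  (hf.prodMk hg).comp scottContinuous_eval

@[fun_prop] theorem scottContinuous_proj {I : Type} {F : I → Type}
    [∀ i, CompletePartialOrder (F i)] (i : I) :
    ScottContinuous (fun x : ∀ i, F i => x i) := fun _ _ _ _ ha => isLUB_pi.1 ha i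

@[fun_prop] theorem ScottContinuous.pi {I : Type} {F : I → Type}
    [∀ i, CompletePartialOrder (F i)] {f : A → ∀ i, F i}
    (h : ∀ i, ScottContinuous (fun x => f x i)) : ScottContinuous f :=
  fun _ hne hd _ ha => isLUB_pi.2 fun i => by
    simpa [Set.image_image, Function.eval] using h i hne hd ha

/-- The function `f`, made strict in the component `s`. -/
def strictIn (s : Cont A B) (f : Cont A E) : Cont A E where
  toFun a := open Classical in if s a = ⊥ then ⊥ else f a
  cont' := by
    classical
    intro d hne hd a ha
    have hs := s.cont hne hd ha
    have hf := f.cont hne hd ha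
    constructor
    · rintro _ ⟨x, hx, rfl⟩
      dsimp only
      by_cases h1 : s x = ⊥
      · simp [h1]
      · have h2 : s a ≠ ⊥ := fun e => h1 (le_bot_iff.1 (e ▸ s.mono (ha.1 hx)))
        simp only [h1, h2, if_false]
        exact f.mono (ha.1 hx)
    · intro b hb
      dsimp only
      split_ifs with h
      · exact bot_le
      · obtain ⟨y, hy, hyb⟩ : ∃ y ∈ d, s y ≠ ⊥ := by
          by_contra! hall
          refine h (le_bot_iff.1 (hs.2 ?_))
          rintro _ ⟨x, hx, rfl⟩
          exact (hall x hx).le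
        refine hf.2 ?_
        rintro _ ⟨x, hx, rfl⟩
        obtain ⟨z, hz, hxz, hyz⟩ := hd x hx y hy
        have hzb : s z ≠ ⊥ := fun e => hyb (le_bot_iff.1 (e ▸ s.mono hyz))
        have := hb ⟨z, hz, rfl⟩
        simp only [hzb, if_false] at this
        exact (f.mono hxz).trans this

/-- The iterates `⊥`, `a ↦ f (a, ⊥)`, `a ↦ f (a, f (a, ⊥))`, ... -/
def iter (f : Cont (A × D) D) : ℕ → Cont A D
  | 0 => ⊥
  | n + 1 => ⟨fun a => f (a, iter f n a), by fun_prop⟩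

/-- The parametrized least fixed point: `sfix f a` is the least fixed point of `x ↦ f (a, x)`. -/
def sfix (f : Cont (A × D) D) : Cont A D := ⨆ n, iter f n

/-- The trace operator, fixing the component `D` of `f`. -/
def trace (f : Cont (A × D) (B × D)) : Cont A B :=
  ⟨fun a => (f (a, sfix ⟨fun w => (f w).2, by fun_prop⟩ a)).1, by fun_prop⟩

end Cont

/-! ### Lifting and coalesced sums -/

theorem exists_lub_withBot {P : Type} [PartialOrder P]
    (h : ∀ s : Set P, s.Nonempty → DirectedOn (· ≤ ·) s → ∃ x, IsLUB s x)
    (s : Set (WithBot P)) (hs : DirectedOn (· ≤ ·) s) : ∃ x, IsLUB s x := by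
  by_cases hne : ∃ p : P, (p : WithBot P) ∈ s
  · obtain ⟨x, hx⟩ := h {p | (p : WithBot P) ∈ s} hne (by
      intro p hp q hq
      obtain ⟨r, hr, hpr, hqr⟩ := hs _ hp _ hq
      induction r with
      | bot => simp at hpr
      | coe r => exact ⟨r, hr, by simpa using hpr, by simpa using hqr⟩)
    refine ⟨x, ?_, ?_⟩
    · intro y hy
      induction y with
      | bot => exact bot_le
      | coe y => exact WithBot.coe_le_coe.2 (hx.1 hy)
    · intro b hb
      obtain ⟨p, hp⟩ := hne
      induction b with
      | bot => simpa using hb hp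
      | coe b => exact WithBot.coe_le_coe.2 (hx.2 fun q hq => WithBot.coe_le_coe.1 (hb hq))
  · push Not at hne
    refine ⟨⊥, fun y hy => ?_, fun _ _ => bot_le⟩
    induction y with
    | bot => exact le_rfl
    | coe y => exact absurd hy (hne y)

/-- A monotone function is continuous out of `WithBot P` if it is so on `P`. -/
theorem scottContinuous_withBot {P : Type} [PartialOrder P] {E : Type} [CompletePartialOrder E]
    {f : WithBot P → E} (h0 : f ⊥ = ⊥)
    (h : ScottContinuous (fun p : P => f p)) : ScottContinuous f := by
  intro d hne hd a ha
  have hm : Monotone f := by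
    intro x y hxy
    induction x with
    | bot => rw [h0]; exact bot_le
    | coe x =>
      induction y with
      | bot => simp at hxy
      | coe y => exact h.monotone (WithBot.coe_le_coe.1 hxy)
  refine ⟨?_, fun b hb => ?_⟩
  · rintro _ ⟨x, hx, rfl⟩
    exact hm (ha.1 hx)
  · induction a using WithBot.recBotCoe with
    | bot => rw [h0]; exact bot_le
    | coe a =>
      have hne' : ∃ p : P, (p : WithBot P) ∈ d := by
        by_contra! hall
        have : (a : WithBot P) ≤ ⊥ := ha.2 fun y hy => by
          induction y with
          | bot => exact le_rfl
          | coe y => exact absurd hy (hall y)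
        simp at this
      have hl : IsLUB {p : P | (p : WithBot P) ∈ d} a :=
        ⟨fun p hp => WithBot.coe_le_coe.1 (ha.1 hp), fun b hb => by
          refine WithBot.coe_le_coe.1 (ha.2 fun y hy => ?_)
          induction y with
          | bot => exact bot_le
          | coe y => exact WithBot.coe_le_coe.2 (hb hy)⟩
      refine (h hne' ?_ hl).2 ?_
      · intro p hp q hq
        obtain ⟨r, hr, hpr, hqr⟩ := hd _ hp _ hq
        induction r with
        | bot => simp at hpr
        | coe r => exact ⟨r, hr, by simpa using hpr, by simpa using hqr⟩
      · rintro _ ⟨x, hx, rfl⟩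
        exact hb ⟨_, hx, rfl⟩

/-- The lifting `D_⊥`: a new bottom element is adjoined to `D`. -/
abbrev Lift (D : Type) := WithBot D

instance (D : Type) [CompletePartialOrder D] : CompletePartialOrder (Lift D) :=
  dcpoOf _ fun s _ hs =>
    exists_lub_withBot (fun _ _ ht => ⟨_, ht.isLUB_sSup⟩) s hs

/-- The coalesced sum: the bottom elements of the summands are identified. -/
abbrev CSum {L : Type} (D : L → Type) [∀ l, CompletePartialOrder (D l)] :=
  WithBot (Σ l, {d : D l // d ≠ ⊥})

section Sums

variable {A D E : Type} [CompletePartialOrder A] [CompletePartialOrder D] [CompletePartialOrder E]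

/-- The unit `up` of lifting. -/
def up : Cont D (Lift D) where
  toFun d := (d : WithBot D)
  cont' := fun d hne _ a ha => ⟨by
      rintro _ ⟨x, hx, rfl⟩; exact WithBot.coe_le_coe.2 (ha.1 hx), fun b hb => by
      obtain ⟨x, hx⟩ := hne
      induction b using WithBot.recBotCoe with
      | bot => simpa using hb ⟨x, hx, rfl⟩
      | coe b => exact WithBot.coe_le_coe.2 (ha.2 fun y hy =>
          WithBot.coe_le_coe.1 (hb ⟨y, hy, rfl⟩))⟩

/-- The extension of `f` to a strict function on `D_⊥`. -/
def liftElim (f : Cont D E) : Cont (Lift D) E where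
  toFun x := x.recBotCoe ⊥ f
  cont' := by
    have h : ScottContinuous (fun d : D => f d) := f.cont
    exact scottContinuous_withBot rfl h

/-- The counit `down` of lifting. -/
def down : Cont (Lift D) D := liftElim ⟨fun d => d, by fun_prop⟩

theorem up_ne_bot (d : D) : up d ≠ ⊥ := WithBot.coe_ne_bot

@[simp] theorem down_up (d : D) : down (up d) = d := rfl

variable {L : Type} {F : L → Type} [∀ l, CompletePartialOrder (F l)]

theorem sigma_dir {s : Set (Σ l, {d : F l // d ≠ ⊥})} {l : L} {d : {d : F l // d ≠ ⊥}}
    (hd : ⟨l, d⟩ ∈ s) (hs : DirectedOn (· ≤ ·) s) :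
    (∀ x ∈ s, ∃ e, x = ⟨l, e⟩) ∧
      DirectedOn (· ≤ ·) {e : F l | ∃ h : e ≠ ⊥, ⟨l, ⟨e, h⟩⟩ ∈ s} := by
  constructor
  · rintro ⟨m, e⟩ hx
    obtain ⟨⟨n, z⟩, -, h1, h2⟩ := hs _ hd _ hx
    cases h1; cases h2
    exact ⟨_, rfl⟩
  · rintro x ⟨hx, hxs⟩ y ⟨hy, hys⟩
    obtain ⟨⟨n, z⟩, hz, h1, h2⟩ := hs _ hxs _ hys
    obtain rfl : l = n := by cases h1; rfl
    have h1' : (⟨x, hx⟩ : {d : F l // d ≠ ⊥}) ≤ z :=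
      (Sigma.mk_le_mk_iff (α := fun l => {d : F l // d ≠ ⊥})).1 h1
    have h2' : (⟨y, hy⟩ : {d : F l // d ≠ ⊥}) ≤ z :=
      (Sigma.mk_le_mk_iff (α := fun l => {d : F l // d ≠ ⊥})).1 h2
    exact ⟨z, ⟨z.2, hz⟩, h1', h2'⟩

theorem exists_lub_sigma (s : Set (Σ l, {d : F l // d ≠ ⊥})) (hne : s.Nonempty)
    (hs : DirectedOn (· ≤ ·) s) : ∃ x, IsLUB s x := by
  obtain ⟨⟨l, d⟩, hd⟩ := hne
  obtain ⟨h1, h2⟩ := sigma_dir hd hs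
  have hl := h2.isLUB_sSup
  have hb : sSup {e : F l | ∃ h : e ≠ ⊥, ⟨l, ⟨e, h⟩⟩ ∈ s} ≠ ⊥ := fun e =>
    d.2 (le_bot_iff.1 ((hl.1 ⟨d.2, hd⟩).trans e.le))
  refine ⟨⟨l, ⟨_, hb⟩⟩, fun x hx => ?_, fun b hb => ?_⟩
  · obtain ⟨e, rfl⟩ := h1 x hx
    exact Sigma.LE.fiber _ _ _ (hl.1 ⟨e.2, hx⟩)
  · obtain ⟨m, b⟩ := b
    have := hb hd
    cases this
    refine Sigma.LE.fiber _ _ _ (hl.2 ?_)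
    rintro e ⟨he, hes⟩
    have := hb hes
    cases this with
    | fiber _ _ _ h => exact h

instance : CompletePartialOrder (CSum F) :=
  dcpoOf _ fun s _ hs => exists_lub_withBot exists_lub_sigma s hs

/-- The injection of the summand `l`, which sends `d ≠ ⊥` to the pair `(l, d)`. -/
def inj (l : L) : Cont (F l) (CSum F) where
  toFun d := open Classical in
    if h : d = ⊥ then ⊥ else ((⟨l, ⟨d, h⟩⟩ : Σ l, {d : F l // d ≠ ⊥}) : WithBot _)
  cont' := by
    classical
    intro S hne hd a ha
    have hm : ∀ {x y : F l}, x ≤ y →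
        (if h : x = ⊥ then (⊥ : CSum F) else
          ((⟨l, ⟨x, h⟩⟩ : Σ l, {d : F l // d ≠ ⊥}) : WithBot _)) ≤
        (if h : y = ⊥ then (⊥ : CSum F) else
          ((⟨l, ⟨y, h⟩⟩ : Σ l, {d : F l // d ≠ ⊥}) : WithBot _)) := by
      intro x y hxy
      by_cases hx : x = ⊥
      · simp [hx]
      · have hy : y ≠ ⊥ := fun e => hx (le_bot_iff.1 (e ▸ hxy))
        simp only [hx, hy, dite_false]
        exact WithBot.coe_le_coe.2 (Sigma.LE.fiber _ _ _ hxy)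
    refine ⟨by rintro _ ⟨x, hx, rfl⟩; exact hm (ha.1 hx), fun b hb => ?_⟩
    by_cases h : a = ⊥
    · simp [h]
    · simp only [h, dite_false]
      obtain ⟨y, hy, hyb⟩ : ∃ y ∈ S, y ≠ ⊥ := by
        by_contra! hall
        exact h (le_bot_iff.1 (ha.2 fun x hx => (hall x hx).le))
      have hb' := hb ⟨y, hy, rfl⟩
      simp only [hyb, dite_false] at hb'
      induction b using WithBot.recBotCoe with
      | bot => simp at hb'
      | coe b =>
        obtain ⟨m, b⟩ := b
        have := WithBot.coe_le_coe.1 hb'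
        cases this
        refine WithBot.coe_le_coe.2 (Sigma.LE.fiber _ _ _ (ha.2 fun x hx => ?_))
        by_cases hxb : x = ⊥
        · simp [hxb]
        · have := hb ⟨x, hx, rfl⟩
          simp only [hxb, dite_false] at this
          cases WithBot.coe_le_coe.1 this with
          | fiber _ _ _ h => exact h

/-- Case analysis on a coalesced sum, strict in it: the value is `⊥` at `⊥` and `f l (a, d)` at
`(l, d)`. -/
def sumCase (f : ∀ l, Cont (A × F l) E) : Cont (A × CSum F) E where
  toFun w := WithBot.recBotCoe ⊥ (fun p : Σ l, {d : F l // d ≠ ⊥} => f p.1 (w.1, p.2)) w.2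
  cont' := by
    refine ScottContinuous.fromProd (fun a => ?_) (fun x => ?_)
    · refine scottContinuous_withBot rfl ?_
      rintro S ⟨⟨l, y⟩, hy⟩ hd ⟨m, d⟩ ha
      obtain rfl : l = m := by cases ha.1 hy; rfl
      obtain ⟨h1, h2⟩ := sigma_dir hy hd
      have hl : IsLUB {e : F l | ∃ h : e ≠ ⊥, ⟨l, ⟨e, h⟩⟩ ∈ S} (d : F l) := by
        refine ⟨?_, fun b hb => ?_⟩
        · rintro e ⟨he, hes⟩
          cases ha.1 hes with
          | fiber _ _ _ h => exact h
        · have hbb : b ≠ ⊥ := fun e => y.2 (le_bot_iff.1 ((hb ⟨y.2, hy⟩).trans e.le))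
          have : (⟨l, d⟩ : Σ l, {d : F l // d ≠ ⊥}) ≤ ⟨l, ⟨b, hbb⟩⟩ := ha.2 fun x hx => by
            obtain ⟨e, rfl⟩ := h1 x hx
            exact Sigma.LE.fiber _ _ _ (hb ⟨e.2, hx⟩)
          cases this with
          | fiber _ _ _ h => exact h
      have hf : ScottContinuous (fun e => f l (a, e)) := by fun_prop
      have hn : {e : F l | ∃ h : e ≠ ⊥, ⟨l, ⟨e, h⟩⟩ ∈ S}.Nonempty := ⟨y.1, y.2, hy⟩
      have := hf hn h2 hl
      convert this using 1
      · ext z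
        constructor
        · rintro ⟨x, hx, rfl⟩
          obtain ⟨e, rfl⟩ := h1 x hx
          exact ⟨e, ⟨e.2, hx⟩, rfl⟩
        · rintro ⟨e, ⟨he, hes⟩, rfl⟩
          exact ⟨⟨l, ⟨e, he⟩⟩, hes, rfl⟩
      · rfl
    · induction x using WithBot.recBotCoe with
      | bot => exact ScottContinuous.const _
      | coe p =>
        have : ScottContinuous (fun a => f p.1 (a, (p.2 : F p.1))) := by fun_prop
        exact this

theorem sumCase_bot (f : ∀ l, Cont (A × F l) E) (a : A) : sumCase f (a, ⊥) = ⊥ := rfl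

theorem sumCase_inj (f : ∀ l, Cont (A × F l) E) (a : A) {l : L} {d : F l} (h : d ≠ ⊥) :
    sumCase f (a, inj l d) = f l (a, d) := by
  have : inj (F := F) l d = ((⟨l, ⟨d, h⟩⟩ : Σ l, {d : F l // d ≠ ⊥}) : WithBot _) := dif_neg h
  rw [this]
  rfl

end Sums

/-! ### The category of pointed dcpos and strict continuous functions -/

section Sub

variable {A D : Type} [CompletePartialOrder A] [CompletePartialOrder D]

/-- A property that holds at `⊥` and is closed under directed least upper bounds. -/
structure Admissible (p : D → Prop) : Prop where
  bot : p ⊥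
  lub : ∀ (S : Set D), S.Nonempty → DirectedOn (· ≤ ·) S → (∀ x ∈ S, p x) → ∀ a, IsLUB S a → p a

/-- The sub-dcpo carved out by an admissible property. -/
@[reducible]
def subDcpo {p : D → Prop} (hp : Admissible p) : CompletePartialOrder {x // p x} :=
  letI : OrderBot {x // p x} := { bot := ⟨⊥, hp.bot⟩, bot_le := fun _ => bot_le (α := D) }
  dcpoOf _ fun S hne hS => by
    have hd : DirectedOn (· ≤ ·) (Subtype.val '' S) := hS.mono_comp (fun _ _ h => h)
    have hl := hd.isLUB_sSup
    refine ⟨⟨_, hp.lub _ (hne.image _) hd ?_ _ hl⟩, fun x hx => hl.1 ⟨x, hx, rfl⟩, fun b hb => ?_⟩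
    · rintro _ ⟨x, -, rfl⟩
      exact x.2
    · exact hl.2 (by rintro _ ⟨x, hx, rfl⟩; exact hb hx)

theorem scottContinuous_mk {p : D → Prop} {f : A → {x // p x}}
    (h : ScottContinuous (fun a => (f a : D))) : ScottContinuous f := by
  intro S hne hd a ha
  have := h hne hd ha
  exact ⟨by rintro _ ⟨x, hx, rfl⟩; exact this.1 ⟨x, hx, rfl⟩, fun b hb => this.2 (by
    rintro _ ⟨x, hx, rfl⟩; exact hb ⟨x, hx, rfl⟩)⟩

theorem scottContinuous_val {p : D → Prop} (hp : Admissible p) :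
    ScottContinuous (Subtype.val : {x // p x} → D) := by
  intro S hne hd a ha
  have hd' : DirectedOn (· ≤ ·) (Subtype.val '' S) := hd.mono_comp (fun _ _ h => h)
  have hl := hd'.isLUB_sSup
  have hq : p (sSup (Subtype.val '' S)) := hp.lub _ (hne.image _) hd' (by
    rintro _ ⟨x, -, rfl⟩; exact x.2) _ hl
  have : a = ⟨_, hq⟩ := ha.unique
    ⟨fun x hx => hl.1 ⟨x, hx, rfl⟩, fun b hb => hl.2 (by rintro _ ⟨x, hx, rfl⟩; exact hb hx)⟩
  rw [this]
  exact hl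

end Sub

theorem admissible_strict (D E : Type) [CompletePartialOrder D] [CompletePartialOrder E] :
    Admissible (fun f : Cont D E => f ⊥ = ⊥) where
  bot := rfl
  lub S _ hd h a ha := by
    refine le_bot_iff.1 ((Cont.isLUB_apply hd ha ⊥).2 ?_)
    rintro _ ⟨f, hf, rfl⟩
    exact (h f hf).le

/-- Strict continuous functions. -/
abbrev Strict (D E : Type) [CompletePartialOrder D] [CompletePartialOrder E] :=
  {f : Cont D E // f ⊥ = ⊥}

instance (D E : Type) [CompletePartialOrder D] [CompletePartialOrder E] :
    CompletePartialOrder (Strict D E) := subDcpo (admissible_strict D E)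

/-- Pointed dcpos, as the objects of a category whose morphisms are strict. -/
structure Dom : Type 1 where
  carrier : Type
  [dcpo : CompletePartialOrder carrier]

instance : CoeSort Dom Type := ⟨Dom.carrier⟩

instance (D : Dom) : CompletePartialOrder D := D.dcpo

instance : Category Dom where
  Hom D E := Strict D E
  id D := ⟨⟨fun x => x, by fun_prop⟩, rfl⟩
  comp f g := ⟨g.1.comp f.1, (congrArg g.1 f.2).trans g.2⟩

/-- The continuous function underlying a morphism. -/
def fn {D E : Dom} (f : D ⟶ E) : Cont D E := Subtype.val (p := fun f : Cont D E => f ⊥ = ⊥) f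

@[simp] theorem fn_bot {D E : Dom} (f : D ⟶ E) : fn f ⊥ = ⊥ :=
  Subtype.property (p := fun f : Cont D E => f ⊥ = ⊥) f

@[simp] theorem fn_id {D : Dom} (x : D) : fn (𝟙 D) x = x := rfl

@[simp] theorem fn_comp {D E F : Dom} (f : D ⟶ E) (g : E ⟶ F) (x : D) :
    fn (f ≫ g) x = fn g (fn f x) := rfl

theorem hom_ext {D E : Dom} {f g : D ⟶ E} (h : ∀ x, fn f x = fn g x) : f = g :=
  Subtype.ext (Cont.ext h)

def homMk {D E : Dom} (f : Cont D E) (h : f ⊥ = ⊥) : D ⟶ E := ⟨f, h⟩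

@[simp] theorem fn_homMk {D E : Dom} (f : Cont D E) (h : f ⊥ = ⊥) : fn (homMk f h) = f := rfl

/-- The terminal domain `{⊥}`. -/
def unitDom : Dom := ⟨Unit⟩

/-! ### Functors used to interpret types -/

/-- `D ↦ D_⊥`. -/
def liftF : Dom ⥤ Dom where
  obj D := ⟨Lift D⟩
  map f := homMk (liftElim (up.comp (fn f))) rfl
  map_id _ := hom_ext fun x => by induction x using WithBot.recBotCoe <;> rfl
  map_comp _ _ := hom_ext fun x => by induction x using WithBot.recBotCoe <;> rfl

/-- `(D, E) ↦ D × E`. -/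
def prodF : Dom × Dom ⥤ Dom where
  obj D := ⟨D.1 × D.2⟩
  map f := homMk ⟨fun x => (fn f.1 x.1, fn f.2 x.2), by fun_prop⟩
    (Prod.ext (fn_bot f.1) (fn_bot f.2))

/-- `(D_l)_l ↦ ∏_l D_l`. -/
def piF (L : Type) : (L → Dom) ⥤ Dom where
  obj D := ⟨∀ l, D l⟩
  map f := homMk ⟨fun x l => fn (f l) (x l), by fun_prop⟩ (funext fun l => fn_bot (f l))

/-- `(D_l)_l ↦ ⨁_l D_l`. -/
def sumF (L : Type) : (L → Dom) ⥤ Dom where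
  obj D := ⟨CSum fun l => D l⟩
  map {D E} f := homMk ((sumCase (A := Unit) fun l =>
      ⟨fun w => inj (F := fun l => E l) l (fn (f l) w.2), by fun_prop⟩).comp
        ⟨fun x => ((), x), by fun_prop⟩) rfl
  map_id D := hom_ext fun x => by
    induction x using WithBot.recBotCoe with
    | bot => rfl
    | coe x => exact dif_neg x.2.2
  map_comp {D E G} f g := hom_ext fun x => by
    induction x using WithBot.recBotCoe with
    | bot => rfl
    | coe x =>
      obtain ⟨l, x, hx⟩ := x
      change inj (F := fun l => G l) l (fn (g l) (fn (f l) x)) =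
        sumCase (A := Unit) (fun l => ⟨fun w => inj (F := fun l => G l) l (fn (g l) w.2),
          by fun_prop⟩) ((), inj (F := fun l => E l) l (fn (f l) x))
      by_cases h : fn (f l) x = ⊥
      · have e : inj (F := fun l => E l) l (fn (f l) x) = ⊥ := dif_pos h
        rw [e, h, fn_bot]
        exact dif_pos rfl
      · rw [sumCase_inj _ _ h]
        rfl

/-! ### Solutions of recursive domain equations

A session type has a negative and a positive aspect, and we solve for both at once. -/

/-- Polarities. -/
inductive Pol
  | neg
  | pos

/-- A pair of domains: a negative and a positive aspect. -/
abbrev Asp := Pol → Dom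

/-- The approximants `{⊥}`, `T {⊥}`, `T (T {⊥})`, ... -/
def chain (T : Asp ⥤ Asp) : ℕ → Asp
  | 0 => fun _ => unitDom
  | n + 1 => T.obj (chain T n)

/-- The projections between consecutive approximants. -/
def chainProj (T : Asp ⥤ Asp) : ∀ n, chain T (n + 1) ⟶ chain T n
  | 0 => fun _ => homMk ⊥ rfl
  | n + 1 => T.map (chainProj T n)

theorem admissible_fix (T : Asp ⥤ Asp) (q : Pol) :
    Admissible fun x : ∀ n, chain T n q => ∀ n, fn (chainProj T n q) (x (n + 1)) = x n where
  bot n := fn_bot _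
  lub S hne hd h a ha n := by
    have h1 := (show ScottContinuous fun x : ∀ n, chain T n q =>
      fn (chainProj T n q) (x (n + 1)) by fun_prop) hne hd ha
    have h2 := (show ScottContinuous fun x : ∀ n, chain T n q => x n by fun_prop) hne hd ha
    rw [Set.image_congr fun x hx => h x hx n] at h1
    exact h1.unique h2

/-- The canonical fixed point of `T`, the limit of its approximants along the projections. -/
def fixObj (T : Asp ⥤ Asp) : Asp := fun q =>
  letI := subDcpo (admissible_fix T q)
  ⟨{x : ∀ n, chain T n q // ∀ n, fn (chainProj T n q) (x (n + 1)) = x n}⟩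

/-- The projections of the fixed point to the approximants. -/
def fixProj (T : Asp ⥤ Asp) (n : ℕ) : fixObj T ⟶ chain T n := fun q =>
  homMk (D := fixObj T q) ⟨fun x => x.1 n, by
    let _ := subDcpo (admissible_fix T q)
    exact (scottContinuous_val (admissible_fix T q)).comp (scottContinuous_proj n)⟩ rfl

theorem fixProj_comp (T : Asp ⥤ Asp) (n : ℕ) :
    fixProj T (n + 1) ≫ chainProj T n = fixProj T n :=
  funext fun _ => hom_ext fun x => x.2 n

/-- The universal property of the fixed point as a limit. -/
def fixLift (T : Asp ⥤ Asp) {X : Asp} (f : ∀ n, X ⟶ chain T n)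
    (hf : ∀ n, f (n + 1) ≫ chainProj T n = f n) : X ⟶ fixObj T := fun q =>
  homMk (E := fixObj T q) ⟨fun x => ⟨fun n => fn (f n q) x, fun n =>
      congrArg (fun h : X ⟶ chain T n => fn (h q) x) (hf n)⟩, by
    let _ := subDcpo (admissible_fix T q)
    exact scottContinuous_mk (by fun_prop)⟩ (Subtype.ext (funext fun n => fn_bot (f n q)))

theorem fix_ext (T : Asp ⥤ Asp) {X : Asp} {f g : X ⟶ fixObj T}
    (h : ∀ n, f ≫ fixProj T n = g ≫ fixProj T n) : f = g :=
  funext fun q => hom_ext fun x => Subtype.ext (funext fun n =>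
    congrArg (fun k : X ⟶ chain T n => fn (k q) x) (h n))

theorem fixLift_proj (T : Asp ⥤ Asp) {X : Asp} (f : ∀ n, X ⟶ chain T n)
    (hf : ∀ n, f (n + 1) ≫ chainProj T n = f n) (n : ℕ) : fixLift T f hf ≫ fixProj T n = f n := rfl

def chainMap {T T' : Asp ⥤ Asp} (t : T ⟶ T') : ∀ n, chain T n ⟶ chain T' n
  | 0 => 𝟙 _
  | n + 1 => T.map (chainMap t n) ≫ t.app _

theorem chainMap_proj {T T' : Asp ⥤ Asp} (t : T ⟶ T') (n : ℕ) :
    chainMap t (n + 1) ≫ chainProj T' n = chainProj T n ≫ chainMap t n := by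
  induction n with
  | zero => rfl
  | succ n ih =>
    change (T.map (chainMap t (n + 1)) ≫ t.app _) ≫ T'.map _ = T.map _ ≫ T.map _ ≫ t.app _
    rw [Category.assoc, ← t.naturality, ← Category.assoc, ← T.map_comp, ih, T.map_comp,
      Category.assoc]

/-- Canonical fixed points of functors, as a functor. -/
def fixF : (Asp ⥤ Asp) ⥤ Asp where
  obj T := fixObj T
  map {T T'} t := fixLift T' (fun n => fixProj T n ≫ chainMap t n) fun n => by
    rw [Category.assoc, chainMap_proj, ← Category.assoc, fixProj_comp]
  map_id T := fix_ext T fun n => by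
    rw [fixLift_proj, Category.id_comp]
    have : chainMap (𝟙 T) n = 𝟙 _ := by
      induction n with
      | zero => rfl
      | succ n ih =>
        change T.map _ ≫ 𝟙 _ = _
        rw [ih]
        simp [chain]
    rw [this, Category.comp_id]
  map_comp {T T' T''} s t := fix_ext T'' fun n => by
    rw [fixLift_proj, Category.assoc, fixLift_proj, ← Category.assoc, fixLift_proj,
      Category.assoc]
    congr 1
    induction n with
    | zero => rfl
    | succ n ih =>
      change T.map _ ≫ (s.app _ ≫ t.app _) = (T.map _ ≫ s.app _) ≫ T'.map _ ≫ t.app _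
      rw [ih, T.map_comp, Category.assoc, Category.assoc, ← s.naturality_assoc]

/-- `Fold : T (FIX T) ⟶ FIX T`. -/
def fold (T : Asp ⥤ Asp) : T.obj (fixObj T) ⟶ fixObj T :=
  fixLift T (fun
    | 0 => fun _ => homMk ⊥ rfl
    | n + 1 => T.map (fixProj T n)) fun
    | 0 => rfl
    | n + 1 => (T.map_comp _ _).symm.trans (congrArg T.map (fixProj_comp T n))

/-- The embeddings of the approximants into the fixed point. -/
def fixEmb (T : Asp ⥤ Asp) : ∀ n, chain T n ⟶ fixObj T
  | 0 => fun _ => homMk ⊥ rfl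
  | n + 1 => T.map (fixEmb T n) ≫ fold T

/-- `Unfold : FIX T → T (FIX T)`, the inverse of `Fold`: the supremum of the projections of `FIX T`
to the approximants `T (chain T n)`, followed by their embeddings into `T (FIX T)`. -/
def unfold (T : Asp ⥤ Asp) (q : Pol) : Cont (fixObj T q) (T.obj (fixObj T) q) :=
  ⨆ n, fn ((fixProj T (n + 1) ≫ T.map (fixEmb T n)) q)

/-- Parametrized canonical fixed points: `c ↦ FIX (G (c, -))`. -/
def fixP {C : Type 1} [Category.{0} C] (G : C × Asp ⥤ Asp) : C ⥤ Asp :=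
  Functor.curry.obj G ⋙ fixF

theorem fixP_comp {C C' : Type 1} [Category.{0} C] [Category.{0} C'] (H : C' ⥤ C)
    (G : C × Asp ⥤ Asp) : fixP (H.prod (𝟭 Asp) ⋙ G) = H ⋙ fixP G := by
  have : Functor.curry.obj (H.prod (𝟭 Asp) ⋙ G) = H ⋙ Functor.curry.obj G := by
    apply Functor.uncurry_obj_injective
    rw [Functor.uncurry_obj_curry_obj]
    conv_lhs => rw [← Functor.uncurry_obj_curry_obj G]
    rfl
  rw [fixP, this]
  rfl

/-! ### Types -/

/-- Names of channels and of functional variables. -/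
abbrev Name := ℕ

/-- Labels of choices. -/
abbrev Label := ℕ

/-- Type variables, as de Bruijn indices: `Var Ξ p` is the set of variables of polarity `p` in the
context `Ξ`. -/
inductive Var : List Pol → Pol → Type
  | zero {Ξ : List Pol} {p : Pol} : Var (p :: Ξ) p
  | succ {Ξ : List Pol} {p q : Pol} : Var Ξ p → Var (q :: Ξ) p

mutual

/-- Session types `Ξ ⊢ A type_s^p`. -/
inductive SType : List Pol → Pol → Type
  /-- The unit type `1`. -/
  | one {Ξ : List Pol} : SType Ξ .pos
  | var {Ξ : List Pol} {p : Pol} : Var Ξ p → SType Ξ p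
  /-- The recursive type `ρα.A`. -/
  | mu {Ξ : List Pol} {p : Pol} : SType (p :: Ξ) p → SType Ξ p
  /-- The downshift `↓A`. -/
  | down {Ξ : List Pol} : SType Ξ .neg → SType Ξ .pos
  /-- The upshift `↑A`. -/
  | up {Ξ : List Pol} : SType Ξ .pos → SType Ξ .neg
  /-- The internal choice `⊕{l : A_l}_{l ∈ L}`. -/
  | plus {Ξ : List Pol} (L : Finset Label) : (L → SType Ξ .pos) → SType Ξ .pos
  /-- The external choice `&{l : A_l}_{l ∈ L}`. -/
  | amp {Ξ : List Pol} (L : Finset Label) : (L → SType Ξ .neg) → SType Ξ .neg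
  /-- The type `B ⊗ A`. -/
  | tensor {Ξ : List Pol} : SType Ξ .pos → SType Ξ .pos → SType Ξ .pos
  /-- The type `B ⊸ A`. -/
  | lolly {Ξ : List Pol} : SType Ξ .pos → SType Ξ .neg → SType Ξ .neg
  /-- The type `τ ∧ A`. -/
  | and {Ξ : List Pol} : FType → SType Ξ .pos → SType Ξ .pos
  /-- The type `τ ⊃ A`. -/
  | imp {Ξ : List Pol} : FType → SType Ξ .neg → SType Ξ .neg

/-- Functional types: function types `τ → σ`, and types `{a : A ← (x : A_x)_{x ∈ dom}}` of quoted
processes, where `a : A` is the provided channel. -/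
inductive FType : Type
  | arrow : FType → FType → FType
  | proc (dom : Finset Name) (pol : dom → Pol) (ty : (x : dom) → SType [] (pol x))
      (a : Name) (p : Pol) (A : SType [] p) : FType

end

def SType.rename {Ξ : List Pol} {p : Pol} : SType Ξ p →
    ∀ {Θ : List Pol}, (∀ q, Var Ξ q → Var Θ q) → SType Θ p
  | .one, _, _ => .one
  | .var v, _, r => .var (r _ v)
  | .mu A, _, r => .mu (A.rename fun
      | _, .zero => .zero
      | _, .succ v => .succ (r _ v))
  | .down A, _, r => .down (A.rename r)
  | .up A, _, r => .up (A.rename r)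
  | .plus L A, _, r => .plus L fun l => (A l).rename r
  | .amp L A, _, r => .amp L fun l => (A l).rename r
  | .tensor B A, _, r => .tensor (B.rename r) (A.rename r)
  | .lolly B A, _, r => .lolly (B.rename r) (A.rename r)
  | .and t A, _, r => .and t (A.rename r)
  | .imp t A, _, r => .imp t (A.rename r)

/-- Simultaneous capture-avoiding substitution. -/
def SType.subst {Ξ : List Pol} {p : Pol} : SType Ξ p →
    ∀ {Θ : List Pol}, (∀ q, Var Ξ q → SType Θ q) → SType Θ p
  | .one, _, _ => .one
  | .var v, _, s => s _ v
  | .mu A, _, s => .mu (A.subst fun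
      | _, .zero => .var .zero
      | _, .succ v => (s _ v).rename fun _ => .succ)
  | .down A, _, s => .down (A.subst s)
  | .up A, _, s => .up (A.subst s)
  | .plus L A, _, s => .plus L fun l => (A l).subst s
  | .amp L A, _, s => .amp L fun l => (A l).subst s
  | .tensor B A, _, s => .tensor (B.subst s) (A.subst s)
  | .lolly B A, _, s => .lolly (B.subst s) (A.subst s)
  | .and t A, _, s => .and t (A.subst s)
  | .imp t A, _, s => .imp t (A.subst s)

/-- The substitution of the closed type `B` for the only variable. -/
def single {p : Pol} (B : SType [] p) : ∀ q, Var [p] q → SType [] q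
  | _, .zero => B

/-- The unfolding `[ρα.A/α]A` of a closed recursive type `ρα.A`. -/
def SType.unroll {p : Pol} (A : SType [p] p) : SType [] p := A.subst (single (.mu A))

/-! ### Interpretation of types -/

/-- The interpretation of a context of type variables: a product of copies of the category of
domains, with one negative and one positive aspect for each variable. -/
abbrev TEnv (Ξ : List Pol) := ∀ q, Var Ξ q → Asp

/-- Extension of an environment. -/
def consF (Ξ : List Pol) (p : Pol) : TEnv Ξ × Asp ⥤ TEnv (p :: Ξ) where
  obj X := fun
    | _, .zero => X.2
    | _, .succ v => X.1 _ v
  map f := fun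
    | _, .zero => f.2
    | _, .succ v => f.1 _ v
  map_id _ := by
    funext q v
    cases v <;> rfl
  map_comp _ _ := by
    funext q v
    cases v <;> rfl

/-- The empty environment. -/
def nilEnv : TEnv [] := fun _ v => nomatch v

/-- The aspects of a choice: `⨁_l (D_l)_⊥` for the direction `r` in which the label is sent, and
`∏_l D_l` for the other direction. -/
def choice {C : Type 1} [Category.{0} C] {L : Type} (r : Pol) (F : L → Pol → C ⥤ Dom) (q : Pol) :
    C ⥤ Dom :=
  match r, q with
  | .neg, .neg => Functor.pi' (fun l => F l .neg ⋙ liftF) ⋙ sumF L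
  | .neg, .pos => Functor.pi' (fun l => F l .pos) ⋙ piF L
  | .pos, .neg => Functor.pi' (fun l => F l .neg) ⋙ piF L
  | .pos, .pos => Functor.pi' (fun l => F l .pos ⋙ liftF) ⋙ sumF L

mutual

/-- The aspects of a session type, as functors from environments to domains. -/
def SType.den : {Ξ : List Pol} → {p : Pol} → SType Ξ p → Pol → (TEnv Ξ ⥤ Dom)
  | _, _, .one => fun
    | .neg => (Functor.const _).obj unitDom
    | .pos => (Functor.const _).obj (liftF.obj unitDom)
  | Ξ, p, .var v => fun q =>
      Pi.eval (fun r => Var Ξ r → Asp) p ⋙ Pi.eval (fun _ : Var Ξ p => Asp) v ⋙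
        Pi.eval (fun _ : Pol => Dom) q
  | Ξ, p, .mu A => fun q =>
      fixP (consF Ξ p ⋙ Functor.pi' fun r => A.den r) ⋙ Pi.eval (fun _ : Pol => Dom) q
  | _, _, .down A => fun
    | .neg => A.den .neg
    | .pos => A.den .pos ⋙ liftF
  | _, _, .up A => fun
    | .neg => A.den .neg ⋙ liftF
    | .pos => A.den .pos
  | _, _, .plus _ A => choice .pos fun l => (A l).den
  | _, _, .amp _ A => choice .neg fun l => (A l).den
  | _, _, .tensor B A => fun
    | .neg => (B.den .neg).prod' (A.den .neg) ⋙ prodF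
    | .pos => (B.den .pos).prod' (A.den .pos) ⋙ prodF ⋙ liftF
  | _, _, .lolly B A => fun
    | .neg => (B.den .pos).prod' (A.den .neg) ⋙ prodF ⋙ liftF
    | .pos => (B.den .neg).prod' (A.den .pos) ⋙ prodF
  | _, _, .and t A => fun
    | .neg => A.den .neg
    | .pos => ((Functor.const _).obj t.den).prod' (A.den .pos) ⋙ prodF ⋙ liftF
  | _, _, .imp t A => fun
    | .neg => ((Functor.const _).obj t.den).prod' (A.den .neg) ⋙ prodF ⋙ liftF
    | .pos => A.den .pos

/-- The domain denoted by a functional type. -/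
def FType.den : FType → Dom
  | .arrow t s => ⟨Strict t.den s.den⟩
  | .proc dom _ ty _ _ A =>
    ⟨Lift (Cont ((∀ x : dom, ((ty x).den .pos).obj nilEnv) × (A.den .neg).obj nilEnv)
      ((∀ x : dom, ((ty x).den .neg).obj nilEnv) × (A.den .pos).obj nilEnv))⟩

end

/-- Reindexing of environments along a renaming. -/
def renF {Ξ Θ : List Pol} (r : ∀ q, Var Ξ q → Var Θ q) : TEnv Θ ⥤ TEnv Ξ where
  obj X := fun q v => X q (r q v)
  map f := fun q v => f q (r q v)

/-- The interpretation of a substitution. -/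
def subF {Ξ Θ : List Pol} (s : ∀ q, Var Ξ q → SType Θ q) : TEnv Θ ⥤ TEnv Ξ :=
  Functor.pi' fun q => Functor.pi' fun v => Functor.pi' fun r => (s q v).den r

theorem functor_ext {C : Type 1} [Category.{0} C] {Ξ : List Pol} {F G : C ⥤ TEnv Ξ}
    (h : ∀ q v r, F ⋙ Pi.eval (fun q => Var Ξ q → Asp) q ⋙ Pi.eval (fun _ : Var Ξ q => Asp) v ⋙
        Pi.eval (fun _ : Pol => Dom) r =
      G ⋙ Pi.eval (fun q => Var Ξ q → Asp) q ⋙ Pi.eval (fun _ : Var Ξ q => Asp) v ⋙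
        Pi.eval (fun _ : Pol => Dom) r) : F = G :=
  Functor.pi_ext _ _ fun q => Functor.pi_ext _ _ fun v => Functor.pi_ext _ _ fun r => h q v r

theorem mu_comp {Ξ Θ : List Pol} {p : Pol} (H : TEnv Θ ⥤ TEnv Ξ)
    (G : TEnv (p :: Θ) ⥤ TEnv (p :: Ξ)) (F : Pol → TEnv (p :: Ξ) ⥤ Dom)
    (h : consF Θ p ⋙ G = H.prod (𝟭 Asp) ⋙ consF Ξ p) :
    fixP (consF Θ p ⋙ Functor.pi' fun r => G ⋙ F r) =
      H ⋙ fixP (consF Ξ p ⋙ Functor.pi' F) := by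
  rw [← fixP_comp]
  change fixP ((consF Θ p ⋙ G) ⋙ Functor.pi' F) = _
  rw [h]
  rfl

theorem SType.den_rename {Ξ : List Pol} {p : Pol} : ∀ (A : SType Ξ p) {Θ : List Pol}
    (r : ∀ q, Var Ξ q → Var Θ q), (A.rename r).den = fun q => renF r ⋙ A.den q
  | .one, _, r => by funext q; cases q <;> rfl
  | .var v, _, r => rfl
  | .mu A, Θ, r => by
    have h := A.den_rename (Θ := p :: Θ) fun
      | _, .zero => .zero
      | _, .succ v => .succ (r _ v)
    funext q
    rw [SType.rename, SType.den, h, mu_comp (renF r)]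
    · rfl
    · refine functor_ext (C := TEnv Θ × Asp) fun q v r => ?_
      cases v <;> rfl
  | .down A, _, r => by
    have h := A.den_rename r
    funext q; cases q <;> simp only [SType.rename, SType.den, h] <;> rfl
  | .up A, _, r => by
    have h := A.den_rename r
    funext q; cases q <;> simp only [SType.rename, SType.den, h] <;> rfl
  | .plus L A, _, r => by
    have h l := (A l).den_rename r
    funext q; cases q <;> simp only [SType.rename, SType.den, h] <;> rfl
  | .amp L A, _, r => by
    have h l := (A l).den_rename r
    funext q; cases q <;> simp only [SType.rename, SType.den, h] <;> rfl
  | .tensor B A, _, r => by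
    have h := A.den_rename r
    have h' := B.den_rename r
    funext q; cases q <;> simp only [SType.rename, SType.den, h, h'] <;> rfl
  | .lolly B A, _, r => by
    have h := A.den_rename r
    have h' := B.den_rename r
    funext q; cases q <;> simp only [SType.rename, SType.den, h, h'] <;> rfl
  | .and t A, _, r => by
    have h := A.den_rename r
    funext q; cases q <;> simp only [SType.rename, SType.den, h] <;> rfl
  | .imp t A, _, r => by
    have h := A.den_rename r
    funext q; cases q <;> simp only [SType.rename, SType.den, h] <;> rfl

/-- Syntactic substitution is interpreted by composition. -/
theorem SType.den_subst {Ξ : List Pol} {p : Pol} : ∀ (A : SType Ξ p) {Θ : List Pol}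
    (s : ∀ q, Var Ξ q → SType Θ q), (A.subst s).den = fun q => subF s ⋙ A.den q
  | .one, _, s => by funext q; cases q <;> rfl
  | .var v, _, s => rfl
  | .mu A, Θ, s => by
    have h := A.den_subst (Θ := p :: Θ) fun
      | _, .zero => .var .zero
      | _, .succ v => (s _ v).rename fun _ => .succ
    funext q
    rw [SType.subst, SType.den, h, mu_comp (subF s)]
    · rfl
    · refine functor_ext (C := TEnv Θ × Asp) fun q v r => ?_
      cases v with
      | zero => rfl
      | succ v =>
        change consF Θ p ⋙ ((s q v).rename fun _ => .succ).den r = _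
        rw [SType.den_rename]
        rfl
  | .down A, _, s => by
    have h := A.den_subst s
    funext q; cases q <;> simp only [SType.subst, SType.den, h] <;> rfl
  | .up A, _, s => by
    have h := A.den_subst s
    funext q; cases q <;> simp only [SType.subst, SType.den, h] <;> rfl
  | .plus L A, _, s => by
    have h l := (A l).den_subst s
    funext q; cases q <;> simp only [SType.subst, SType.den, h] <;> rfl
  | .amp L A, _, s => by
    have h l := (A l).den_subst s
    funext q; cases q <;> simp only [SType.subst, SType.den, h] <;> rfl
  | .tensor B A, _, s => by
    have h := A.den_subst s
    have h' := B.den_subst s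
    funext q; cases q <;> simp only [SType.subst, SType.den, h, h'] <;> rfl
  | .lolly B A, _, s => by
    have h := A.den_subst s
    have h' := B.den_subst s
    funext q; cases q <;> simp only [SType.subst, SType.den, h, h'] <;> rfl
  | .and t A, _, s => by
    have h := A.den_subst s
    funext q; cases q <;> simp only [SType.subst, SType.den, h] <;> rfl
  | .imp t A, _, s => by
    have h := A.den_subst s
    funext q; cases q <;> simp only [SType.subst, SType.den, h] <;> rfl

/-- Closed session types, of either polarity. -/
abbrev CType := Σ p, SType [] p

/-- An aspect of a closed session type. -/
def CType.den (A : CType) (q : Pol) : Dom := (A.2.den q).obj nilEnv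

/-- The functor whose canonical fixed point is the denotation of `ρα.A`. -/
def muF {p : Pol} (A : SType [p] p) : Asp ⥤ Asp :=
  (Functor.curry.obj (consF [] p ⋙ Functor.pi' fun r => A.den r)).obj nilEnv

theorem den_mu {p : Pol} (A : SType [p] p) (q : Pol) :
    CType.den ⟨p, .mu A⟩ q = fixObj (muF A) q := rfl

theorem den_unroll {p : Pol} (A : SType [p] p) (q : Pol) :
    CType.den ⟨p, A.unroll⟩ q = (muF A).obj (fixObj (muF A)) q := by
  have h : (subF (single (.mu A))).obj nilEnv = (consF [] p).obj (nilEnv, fixObj (muF A)) := by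
    funext r v
    cases v with
    | zero => rfl
    | succ v => cases v
  rw [CType.den, SType.unroll, SType.den_subst]
  exact congrArg (A.den q).obj h

/-- `Fold` for a closed recursive type. -/
def foldFn {p : Pol} (A : SType [p] p) (q : Pol) :
    Cont (CType.den ⟨p, A.unroll⟩ q) (CType.den ⟨p, .mu A⟩ q) :=
  fn (eqToHom (den_unroll A q) ≫ fold (muF A) q)

/-- `Unfold` for a closed recursive type. -/
def unfoldFn {p : Pol} (A : SType [p] p) (q : Pol) :
    Cont (CType.den ⟨p, .mu A⟩ q) (CType.den ⟨p, A.unroll⟩ q) :=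
  (fn (eqToHom (den_unroll A q).symm)).comp (unfold (muF A) q)

/-! ### Contexts -/

/-- Contexts: finite maps from names to types. -/
structure Ctx (T : Type) where
  dom : Finset Name
  ty : dom → T

namespace Ctx

variable {T : Type}

/-- The empty context. -/
def nil : Ctx T := ⟨∅, fun x => absurd x.2 (Finset.notMem_empty _)⟩

/-- The context `Δ, a : A`. It is used for `a` not declared in `Δ`, except for contexts of functional
variables, where a new declaration shadows an old one. -/
def insert (Δ : Ctx T) (a : Name) (A : T) : Ctx T where
  dom := Insert.insert a Δ.dom
  ty x := if h : x.1 = a then A else Δ.ty ⟨x.1, (Finset.mem_insert.1 x.2).resolve_left h⟩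

/-- The context `Δ₁, Δ₂`, for contexts with disjoint domains. -/
def union (Δ₁ Δ₂ : Ctx T) : Ctx T where
  dom := Δ₁.dom ∪ Δ₂.dom
  ty x := if h : x.1 ∈ Δ₁.dom then Δ₁.ty ⟨x.1, h⟩
    else Δ₂.ty ⟨x.1, (Finset.mem_union.1 x.2).resolve_left h⟩

theorem insert_self (Δ : Ctx T) (a : Name) (A : T) :
    (Δ.insert a A).ty ⟨a, Finset.mem_insert_self _ _⟩ = A := dif_pos rfl

theorem insert_of_ne (Δ : Ctx T) {a : Name} (A : T) (x : (Δ.insert a A).dom) (h : x.1 ≠ a) :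
    (Δ.insert a A).ty x = Δ.ty ⟨x.1, (Finset.mem_insert.1 x.2).resolve_left h⟩ := dif_neg h

theorem insert_old {Δ : Ctx T} {a : Name} (A : T) (ha : a ∉ Δ.dom) (x : Δ.dom) :
    (Δ.insert a A).ty ⟨x.1, Finset.mem_insert_of_mem x.2⟩ = Δ.ty x :=
  dif_neg fun h : x.1 = a => ha (h ▸ x.2)

theorem union_left (Δ₁ Δ₂ : Ctx T) (x : (Δ₁.union Δ₂).dom) (h : x.1 ∈ Δ₁.dom) :
    (Δ₁.union Δ₂).ty x = Δ₁.ty ⟨x.1, h⟩ := dif_pos h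

theorem union_right (Δ₁ Δ₂ : Ctx T) (x : (Δ₁.union Δ₂).dom) (h : x.1 ∉ Δ₁.dom) :
    (Δ₁.union Δ₂).ty x = Δ₂.ty ⟨x.1, (Finset.mem_union.1 x.2).resolve_left h⟩ := dif_neg h

variable (E : T → Dom)

/-- The product of the domains `E A`, indexed by the declarations `a : A` of a context. -/
abbrev env (Δ : Ctx T) : Type := ∀ x : Δ.dom, E (Δ.ty x)

/-- Transport along an equality of types. -/
def castE {A B : T} (h : A = B) : Cont (E A) (E B) := fn (eqToHom (congrArg E h))

/-- The element `(δ, a : α)`. -/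
def extend {Δ : Ctx T} {a : Name} {A : T} : Cont (Δ.env E × E A) ((Δ.insert a A).env E) where
  toFun w x := if h : x.1 = a
    then castE E ((insert_self Δ a A).symm.trans
      (congrArg (Δ.insert a A).ty (Subtype.ext h.symm))) w.2
    else castE E (insert_of_ne Δ A x h).symm (w.1 _)
  cont' := ScottContinuous.pi fun x => by
    by_cases h : x.1 = a <;> simp only [h, dite_true, dite_false] <;> fun_prop

/-- The component `a`. -/
def head {Δ : Ctx T} {a : Name} {A : T} : Cont ((Δ.insert a A).env E) (E A) :=
  ⟨fun d => castE E (insert_self Δ a A) (d _), by fun_prop⟩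

/-- The projection which forgets the component `a`. -/
def tail {Δ : Ctx T} {a : Name} {A : T} (ha : a ∉ Δ.dom) :
    Cont ((Δ.insert a A).env E) (Δ.env E) :=
  ⟨fun d x => castE E (insert_old A ha x) (d _), by fun_prop⟩

/-- The element `(δ₁, δ₂)`. -/
def join {Δ₁ Δ₂ : Ctx T} : Cont (Δ₁.env E × Δ₂.env E) ((Δ₁.union Δ₂).env E) where
  toFun w x := if h : x.1 ∈ Δ₁.dom then castE E (union_left Δ₁ Δ₂ x h).symm (w.1 _)
    else castE E (union_right Δ₁ Δ₂ x h).symm (w.2 _)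
  cont' := ScottContinuous.pi fun x => by
    by_cases h : x.1 ∈ Δ₁.dom <;> simp only [h, dite_true, dite_false] <;> fun_prop

/-- The two projections from a union of disjoint contexts. -/
def fork {Δ₁ Δ₂ : Ctx T} (h : Disjoint Δ₁.dom Δ₂.dom) :
    Cont ((Δ₁.union Δ₂).env E) (Δ₁.env E × Δ₂.env E) where
  toFun d :=
    (fun x => castE E (union_left Δ₁ Δ₂ ⟨x.1, Finset.mem_union_left _ x.2⟩ x.2) (d _),
     fun x => castE E (union_right Δ₁ Δ₂ ⟨x.1, Finset.mem_union_right _ x.2⟩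
      (Finset.disjoint_right.1 h x.2)) (d _))
  cont' := by fun_prop

end Ctx

/-- The type `{a : A ← Δ}` of quoted processes. -/
def FType.quot (Δ : Ctx CType) (a : Name) (A : CType) : FType :=
  .proc Δ.dom (fun x => (Δ.ty x).1) (fun x => (Δ.ty x).2) a A.1 A.2

/-! ### Terms and processes

Terms and processes are identified with the derivations of the judgments `Ψ ⊢ M : τ` and
`Ψ ; Δ ⊢ P :: c : C`. A context `Δ, c : C` of channels declares each channel once. -/

mutual

/-- Functional terms, `Ψ ⊢ M : τ`. -/
inductive Term : Ctx FType → FType → Type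
  | var {Ψ : Ctx FType} (x : Ψ.dom) : Term Ψ (Ψ.ty x)
  /-- `fix x.M` -/
  | fix {Ψ : Ctx FType} {t : FType} (x : Name) : Term (Ψ.insert x t) t → Term Ψ t
  /-- `λx : τ.M` -/
  | lam {Ψ : Ctx FType} {s : FType} (x : Name) (t : FType) :
      Term (Ψ.insert x t) s → Term Ψ (.arrow t s)
  | app {Ψ : Ctx FType} {t s : FType} : Term Ψ (.arrow t s) → Term Ψ t → Term Ψ s
  /-- The quoted process `a ← {P} ← Δ`. -/
  | quote {Ψ : Ctx FType} {Δ : Ctx CType} {a : Name} {A : CType} :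
      Proc Ψ Δ a A → Term Ψ (.quot Δ a A)

/-- Processes, `Ψ ; Δ ⊢ P :: c : C`. -/
inductive Proc : Ctx FType → Ctx CType → Name → CType → Type
  /-- `b ← a` -/
  | fwd {Ψ : Ctx FType} (a b : Name) (A : CType) : a ≠ b → Proc Ψ (Ctx.nil.insert a A) b A
  /-- `a ← P; Q` -/
  | cut {Ψ : Ctx FType} {Δ₁ Δ₂ : Ctx CType} {c : Name} {C : CType} (a : Name) (A : CType) :
      Disjoint Δ₁.dom Δ₂.dom → a ∉ Δ₂.dom → c ∉ Δ₁.dom →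
      Proc Ψ Δ₁ a A → Proc Ψ (Δ₂.insert a A) c C → Proc Ψ (Δ₁.union Δ₂) c C
  /-- `close a` -/
  | close {Ψ : Ctx FType} (a : Name) : Proc Ψ Ctx.nil a ⟨_, .one⟩
  /-- `wait a; P` -/
  | wait {Ψ : Ctx FType} {Δ : Ctx CType} {c : Name} {C : CType} (a : Name) :
      a ∉ Δ.dom → a ≠ c → Proc Ψ Δ c C → Proc Ψ (Δ.insert a ⟨_, .one⟩) c C
  /-- `send a shift; P`, for a downshift -/
  | downR {Ψ : Ctx FType} {Δ : Ctx CType} {a : Name} {A : SType [] .neg} :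
      Proc Ψ Δ a ⟨_, A⟩ → Proc Ψ Δ a ⟨_, .down A⟩
  /-- `shift ← recv a; P`, for a downshift -/
  | downL {Ψ : Ctx FType} {Δ : Ctx CType} {c : Name} {C : CType} (a : Name) (A : SType [] .neg) :
      a ∉ Δ.dom → Proc Ψ (Δ.insert a ⟨_, A⟩) c C → Proc Ψ (Δ.insert a ⟨_, .down A⟩) c C
  /-- `shift ← recv a; P`, for an upshift -/
  | upR {Ψ : Ctx FType} {Δ : Ctx CType} {a : Name} {A : SType [] .pos} :
      Proc Ψ Δ a ⟨_, A⟩ → Proc Ψ Δ a ⟨_, .up A⟩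
  /-- `send a shift; P`, for an upshift -/
  | upL {Ψ : Ctx FType} {Δ : Ctx CType} {c : Name} {C : CType} (a : Name) (A : SType [] .pos) :
      a ∉ Δ.dom → Proc Ψ (Δ.insert a ⟨_, A⟩) c C → Proc Ψ (Δ.insert a ⟨_, .up A⟩) c C
  /-- `a.k; P`, for an internal choice -/
  | plusR {Ψ : Ctx FType} {Δ : Ctx CType} {a : Name} {L : Finset Label}
      (A : L → SType [] .pos) (k : L) :
      Proc Ψ Δ a ⟨_, A k⟩ → Proc Ψ Δ a ⟨_, .plus L A⟩
  /-- `case a {l ⇒ P_l}_{l ∈ L}`, for an internal choice -/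
  | plusL {Ψ : Ctx FType} {Δ : Ctx CType} {c : Name} {C : CType} (a : Name) {L : Finset Label}
      (A : L → SType [] .pos) :
      a ∉ Δ.dom → a ≠ c → c ∉ Δ.dom → (∀ l, Proc Ψ (Δ.insert a ⟨_, A l⟩) c C) →
      Proc Ψ (Δ.insert a ⟨_, .plus L A⟩) c C
  /-- `case a {l ⇒ P_l}_{l ∈ L}`, for an external choice -/
  | ampR {Ψ : Ctx FType} {Δ : Ctx CType} {a : Name} {L : Finset Label}
      (A : L → SType [] .neg) :
      a ∉ Δ.dom → (∀ l, Proc Ψ Δ a ⟨_, A l⟩) → Proc Ψ Δ a ⟨_, .amp L A⟩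
  /-- `a.k; P`, for an external choice -/
  | ampL {Ψ : Ctx FType} {Δ : Ctx CType} {c : Name} {C : CType} (a : Name) {L : Finset Label}
      (A : L → SType [] .neg) (k : L) :
      a ∉ Δ.dom → Proc Ψ (Δ.insert a ⟨_, A k⟩) c C → Proc Ψ (Δ.insert a ⟨_, .amp L A⟩) c C
  /-- `send a b; P`, for a tensor -/
  | tensorR {Ψ : Ctx FType} {Δ : Ctx CType} {a : Name} {A : SType [] .pos} (b : Name)
      (B : SType [] .pos) :
      b ∉ Δ.dom → b ≠ a → Proc Ψ Δ a ⟨_, A⟩ → Proc Ψ (Δ.insert b ⟨_, B⟩) a ⟨_, .tensor B A⟩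
  /-- `b ← recv a; P`, for a tensor -/
  | tensorL {Ψ : Ctx FType} {Δ : Ctx CType} {c : Name} {C : CType} (a b : Name)
      (A B : SType [] .pos) :
      a ∉ Δ.dom → b ∉ (Δ.insert a ⟨_, A⟩).dom →
      Proc Ψ ((Δ.insert a ⟨_, A⟩).insert b ⟨_, B⟩) c C → Proc Ψ (Δ.insert a ⟨_, .tensor B A⟩) c C
  /-- `b ← recv a; P`, for a linear implication -/
  | lollyR {Ψ : Ctx FType} {Δ : Ctx CType} {a : Name} {A : SType [] .neg} (b : Name)
      (B : SType [] .pos) :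
      b ∉ Δ.dom → Proc Ψ (Δ.insert b ⟨_, B⟩) a ⟨_, A⟩ → Proc Ψ Δ a ⟨_, .lolly B A⟩
  /-- `send a b; P`, for a linear implication -/
  | lollyL {Ψ : Ctx FType} {Δ : Ctx CType} {c : Name} {C : CType} (a b : Name)
      (A : SType [] .neg) (B : SType [] .pos) :
      b ∉ Δ.dom → b ≠ c → a ∉ (Δ.insert b ⟨_, B⟩).dom → (ha : a ∉ Δ.dom) →
      Proc Ψ (Δ.insert a ⟨_, A⟩) c C →
      Proc Ψ ((Δ.insert b ⟨_, B⟩).insert a ⟨_, .lolly B A⟩) c C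
  /-- `_ ← output a M; P`, for `τ ∧ A` -/
  | andR {Ψ : Ctx FType} {Δ : Ctx CType} {a : Name} {A : SType [] .pos} {t : FType} :
      Term Ψ t → Proc Ψ Δ a ⟨_, A⟩ → Proc Ψ Δ a ⟨_, .and t A⟩
  /-- `x ← input a; P`, for `τ ∧ A` -/
  | andL {Ψ : Ctx FType} {Δ : Ctx CType} {c : Name} {C : CType} (a x : Name) (A : SType [] .pos)
      (t : FType) :
      a ∉ Δ.dom → Proc (Ψ.insert x t) (Δ.insert a ⟨_, A⟩) c C →
      Proc Ψ (Δ.insert a ⟨_, .and t A⟩) c C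
  /-- `x ← input a; P`, for `τ ⊃ A` -/
  | impR {Ψ : Ctx FType} {Δ : Ctx CType} {a : Name} {A : SType [] .neg} (x : Name) (t : FType) :
      Proc (Ψ.insert x t) Δ a ⟨_, A⟩ → Proc Ψ Δ a ⟨_, .imp t A⟩
  /-- `_ ← output a M; P`, for `τ ⊃ A` -/
  | impL {Ψ : Ctx FType} {Δ : Ctx CType} {c : Name} {C : CType} (a : Name) (A : SType [] .neg)
      {t : FType} :
      a ∉ Δ.dom → Term Ψ t → Proc Ψ (Δ.insert a ⟨_, A⟩) c C →
      Proc Ψ (Δ.insert a ⟨_, .imp t A⟩) c C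
  /-- The provider of a recursive type: `send a unfold; P` if it is positive,
  `unfold ← recv a; P` if it is negative. -/
  | muR {Ψ : Ctx FType} {Δ : Ctx CType} {a : Name} {p : Pol} (A : SType [p] p) :
      Proc Ψ Δ a ⟨_, A.unroll⟩ → Proc Ψ Δ a ⟨_, .mu A⟩
  /-- The client of a recursive type: `unfold ← recv a; P` if it is positive,
  `send a unfold; P` if it is negative. -/
  | muL {Ψ : Ctx FType} {Δ : Ctx CType} {c : Name} {C : CType} (a : Name) {p : Pol}
      (A : SType [p] p) :
      a ∉ Δ.dom → Proc Ψ (Δ.insert a ⟨_, A.unroll⟩) c C → Proc Ψ (Δ.insert a ⟨_, .mu A⟩) c C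
  /-- The spawned quoted process `a ← {M} ← Δ`. -/
  | unquote {Ψ : Ctx FType} {Δ : Ctx CType} {a : Name} {A : CType} :
      a ∉ Δ.dom → Term Ψ (.quot Δ a A) → Proc Ψ Δ a A

end

/-! ### Semantic clauses

In each clause `U` interprets the functional variables, `X` and `Y` the positive and negative
aspects of the untouched channels `Δ`, and `An` and `Ap` the negative and positive aspects of the
type of the principal channel `a`. For a process which uses `a`, `Z` and `W` are the negative and
positive aspects of the provided channel. Processes are given in uncurried form. -/

section Clauses

variable {U X Y Z W An Ap Bn Bp T S : Type} [CompletePartialOrder U] [CompletePartialOrder X]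
  [CompletePartialOrder Y] [CompletePartialOrder Z] [CompletePartialOrder W]
  [CompletePartialOrder An] [CompletePartialOrder Ap] [CompletePartialOrder Bn]
  [CompletePartialOrder Bp] [CompletePartialOrder T] [CompletePartialOrder S]

def semLam (M : Cont (U × T) S) : Cont U (Strict T S) where
  toFun u := ⟨(strictIn ⟨fun w => w.2, by fun_prop⟩ M).curry u, if_pos rfl⟩
  cont' := scottContinuous_mk (by fun_prop)

def semApp (M : Cont U (Strict T S)) (N : Cont U T) : Cont U S where
  toFun u := (M u).1 (N u)
  cont' := ScottContinuous.apply (M.cont.comp (scottContinuous_val (admissible_strict T S))) N.cont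

def semFwd : Cont (U × ((X × Ap) × An)) ((Y × An) × Ap) :=
  ⟨fun w => ((⊥, w.2.2), w.2.1.2), by fun_prop⟩

/-- Composition: the trace of `P u × Q u` over `a⁻ × a⁺`, for each `u`. -/
def semCut {X₁ Y₁ X₂ Y₂ : Type} [CompletePartialOrder X₁] [CompletePartialOrder Y₁]
    [CompletePartialOrder X₂] [CompletePartialOrder Y₂] (P : Cont (U × (X₁ × An)) (Y₁ × Ap))
    (Q : Cont (U × ((X₂ × Ap) × Z)) ((Y₂ × An) × W)) :
    Cont (U × ((X₁ × X₂) × Z)) ((Y₁ × Y₂) × W) :=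
  trace (D := An × Ap) ⟨fun w =>
    let p := P (w.1.1, (w.1.2.1.1, w.2.1))
    let q := Q (w.1.1, ((w.1.2.1.2, w.2.2), w.1.2.2))
    (((p.1, q.1.1), q.2), (q.1.2, p.2)), by fun_prop⟩

def semClose : Cont (U × (X × Unit)) (Y × Lift Unit) := ⟨fun _ => (⊥, up ()), by fun_prop⟩

def semWait (P : Cont (U × (X × Z)) (Y × W)) :
    Cont (U × ((X × Lift Unit) × Z)) ((Y × Unit) × W) :=
  strictIn ⟨fun w => w.2.1.2, by fun_prop⟩ ⟨fun w =>
    let r := P (w.1, (w.2.1.1, w.2.2))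
    ((r.1, ()), r.2), by fun_prop⟩

def semDownR (P : Cont (U × (X × An)) (Y × Ap)) : Cont (U × (X × An)) (Y × Lift Ap) :=
  ⟨fun w => ((P w).1, up (P w).2), by fun_prop⟩

def semDownL (P : Cont (U × ((X × Ap) × Z)) ((Y × An) × W)) :
    Cont (U × ((X × Lift Ap) × Z)) ((Y × An) × W) :=
  strictIn ⟨fun w => w.2.1.2, by fun_prop⟩
    ⟨fun w => P (w.1, ((w.2.1.1, SILL.down w.2.1.2), w.2.2)), by fun_prop⟩

def semUpR (P : Cont (U × (X × An)) (Y × Ap)) : Cont (U × (X × Lift An)) (Y × Ap) :=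
  strictIn ⟨fun w => w.2.2, by fun_prop⟩
    ⟨fun w => P (w.1, (w.2.1, SILL.down w.2.2)), by fun_prop⟩

def semUpL (P : Cont (U × ((X × Ap) × Z)) ((Y × An) × W)) :
    Cont (U × ((X × Ap) × Z)) ((Y × Lift An) × W) :=
  ⟨fun w => (((P w).1.1, up (P w).1.2), (P w).2), by fun_prop⟩

section Choice

variable {L : Type} {Fn Fp : L → Type} [∀ l, CompletePartialOrder (Fn l)]
  [∀ l, CompletePartialOrder (Fp l)]

/-- The tuple `(k : x, l ≠ k : ⊥)`. -/
def only (k : L) : Cont (Fn k) (∀ l, Fn l) where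
  toFun x := open Classical in fun l => if h : k = l then h ▸ x else ⊥
  cont' := ScottContinuous.pi fun l => by
    by_cases h : k = l
    · subst h
      simp
    · simp only [h, dite_false]
      exact ScottContinuous.const _

def semPlusR (k : L) (P : Cont (U × (X × Fn k)) (Y × Fp k)) :
    Cont (U × (X × ∀ l, Fn l)) (Y × CSum fun l => Lift (Fp l)) :=
  ⟨fun w =>
    let r := P (w.1, (w.2.1, w.2.2 k))
    (r.1, inj (F := fun l => Lift (Fp l)) k (up r.2)), by fun_prop⟩

def semPlusL (P : ∀ l, Cont (U × ((X × Fp l) × Z)) ((Y × Fn l) × W)) :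
    Cont (U × ((X × CSum fun l => Lift (Fp l)) × Z)) ((Y × ∀ l, Fn l) × W) :=
  (sumCase (A := U × (X × Z)) (F := fun l => Lift (Fp l)) fun l => ⟨fun w =>
    let r := P l (w.1.1, ((w.1.2.1, SILL.down w.2), w.1.2.2))
    ((r.1.1, only l r.1.2), r.2), by fun_prop⟩).comp
  ⟨fun w => ((w.1, (w.2.1.1, w.2.2)), w.2.1.2), by fun_prop⟩

def semAmpR (P : ∀ l, Cont (U × (X × Fn l)) (Y × Fp l)) :
    Cont (U × (X × CSum fun l => Lift (Fn l))) (Y × ∀ l, Fp l) :=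
  (sumCase (A := U × X) (F := fun l => Lift (Fn l)) fun l => ⟨fun w =>
    let r := P l (w.1.1, (w.1.2, SILL.down w.2))
    (r.1, only l r.2), by fun_prop⟩).comp ⟨fun w => ((w.1, w.2.1), w.2.2), by fun_prop⟩

def semAmpL (k : L) (P : Cont (U × ((X × Fp k) × Z)) ((Y × Fn k) × W)) :
    Cont (U × ((X × ∀ l, Fp l) × Z)) ((Y × CSum fun l => Lift (Fn l)) × W) :=
  ⟨fun w =>
    let r := P (w.1, ((w.2.1.1, w.2.1.2 k), w.2.2))
    ((r.1.1, inj (F := fun l => Lift (Fn l)) k (up r.1.2)), r.2), by fun_prop⟩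

end Choice

def semTensorR (P : Cont (U × (X × An)) (Y × Ap)) :
    Cont (U × ((X × Bp) × (Bn × An))) ((Y × Bn) × Lift (Bp × Ap)) :=
  ⟨fun w =>
    let r := P (w.1, (w.2.1.1, w.2.2.2))
    ((r.1, w.2.2.1), up (w.2.1.2, r.2)), by fun_prop⟩

def semTensorL (P : Cont (U × (((X × Ap) × Bp) × Z)) (((Y × An) × Bn) × W)) :
    Cont (U × ((X × Lift (Bp × Ap)) × Z)) ((Y × (Bn × An)) × W) :=
  strictIn ⟨fun w => w.2.1.2, by fun_prop⟩ ⟨fun w =>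
    let v := SILL.down w.2.1.2
    let r := P (w.1, (((w.2.1.1, v.2), v.1), w.2.2))
    ((r.1.1.1, (r.1.2, r.1.1.2)), r.2), by fun_prop⟩

def semLollyR (P : Cont (U × ((X × Bp) × An)) ((Y × Bn) × Ap)) :
    Cont (U × (X × Lift (Bp × An))) (Y × (Bn × Ap)) :=
  strictIn ⟨fun w => w.2.2, by fun_prop⟩ ⟨fun w =>
    let v := SILL.down w.2.2
    let r := P (w.1, ((w.2.1, v.1), v.2))
    (r.1.1, (r.1.2, r.2)), by fun_prop⟩

def semLollyL (P : Cont (U × ((X × Ap) × Z)) ((Y × An) × W)) :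
    Cont (U × (((X × Bp) × (Bn × Ap)) × Z)) (((Y × Bn) × Lift (Bp × An)) × W) :=
  ⟨fun w =>
    let r := P (w.1, ((w.2.1.1.1, w.2.1.2.2), w.2.2))
    (((r.1.1, w.2.1.2.1), up (w.2.1.1.2, r.1.2)), r.2), by fun_prop⟩

def semAndR (M : Cont U T) (P : Cont (U × (X × An)) (Y × Ap)) :
    Cont (U × (X × An)) (Y × Lift (T × Ap)) :=
  strictIn ⟨fun w => M w.1, by fun_prop⟩
    ⟨fun w => ((P w).1, up (M w.1, (P w).2)), by fun_prop⟩

def semAndL (P : Cont ((U × T) × ((X × Ap) × Z)) ((Y × An) × W)) :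
    Cont (U × ((X × Lift (T × Ap)) × Z)) ((Y × An) × W) :=
  strictIn ⟨fun w => w.2.1.2, by fun_prop⟩ ⟨fun w =>
    let v := SILL.down w.2.1.2
    P ((w.1, v.1), ((w.2.1.1, v.2), w.2.2)), by fun_prop⟩

def semImpR (P : Cont ((U × T) × (X × An)) (Y × Ap)) :
    Cont (U × (X × Lift (T × An))) (Y × Ap) :=
  strictIn ⟨fun w => w.2.2, by fun_prop⟩ ⟨fun w =>
    let v := SILL.down w.2.2
    P ((w.1, v.1), (w.2.1, v.2)), by fun_prop⟩

def semImpL (M : Cont U T) (P : Cont (U × ((X × Ap) × Z)) ((Y × An) × W)) :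
    Cont (U × ((X × Ap) × Z)) ((Y × Lift (T × An)) × W) :=
  strictIn ⟨fun w => M w.1, by fun_prop⟩
    ⟨fun w => (((P w).1.1, up (M w.1, (P w).1.2)), (P w).2), by fun_prop⟩

/-- Conversion of the aspects of a provided channel. -/
def semR (f : Cont Bn An) (g : Cont Ap Bp) (P : Cont (U × (X × An)) (Y × Ap)) :
    Cont (U × (X × Bn)) (Y × Bp) :=
  ⟨fun w =>
    let r := P (w.1, (w.2.1, f w.2.2))
    (r.1, g r.2), by fun_prop⟩

/-- Conversion of the aspects of a used channel. -/
def semL (f : Cont Bp Ap) (g : Cont An Bn) (P : Cont (U × ((X × Ap) × Z)) ((Y × An) × W)) :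
    Cont (U × ((X × Bp) × Z)) ((Y × Bn) × W) :=
  ⟨fun w =>
    let r := P (w.1, ((w.2.1.1, f w.2.1.2), w.2.2))
    ((r.1.1, g r.1.2), r.2), by fun_prop⟩

end Clauses

/-! ### Interpretation of terms and processes -/

/-- An aspect of a context of channels. -/
abbrev Ctx.asp (Δ : Ctx CType) (q : Pol) : Type := Δ.env fun A => A.den q

/-- Environments for a context of functional variables. -/
abbrev Ctx.fenv (Ψ : Ctx FType) : Type := Ψ.env FType.den

/-- The domain `[⟦Δ⟧⁺ × ⟦c : C⟧⁻ → ⟦Δ⟧⁻ × ⟦c : C⟧⁺]`. -/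
abbrev PDom (Δ : Ctx CType) (C : CType) : Type :=
  Cont (Δ.asp .pos × C.den .neg) (Δ.asp .neg × C.den .pos)

/-- Denotations of processes in uncurried form. -/
abbrev USem (U : Type) [CompletePartialOrder U] (Δ : Ctx CType) (C : CType) : Type :=
  Cont (U × (Δ.asp .pos × C.den .neg)) (Δ.asp .neg × C.den .pos)

section Plumbing

variable {U : Type} [CompletePartialOrder U] {X Y Z W : Type} [CompletePartialOrder X]
  [CompletePartialOrder Y] [CompletePartialOrder Z] [CompletePartialOrder W]
  {Δ Δ₁ Δ₂ : Ctx CType} {a : Name} {A : CType}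

/-- Separates the channel `a` from the others. -/
def unl (ha : a ∉ Δ.dom) (P : Cont (U × ((Δ.insert a A).asp .pos × Z))
    ((Δ.insert a A).asp .neg × W)) :
    Cont (U × ((Δ.asp .pos × A.den .pos) × Z)) ((Δ.asp .neg × A.den .neg) × W) :=
  ⟨fun w =>
    let r := P (w.1, (Ctx.extend (fun A : CType => A.den .pos) w.2.1, w.2.2))
    ((Ctx.tail (fun A : CType => A.den .neg) ha r.1,
      Ctx.head (fun A : CType => A.den .neg) (Δ := Δ) r.1), r.2), by fun_prop⟩

/-- Adjoins the channel `a` to the others. -/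
def mkl (ha : a ∉ Δ.dom)
    (P : Cont (U × ((Δ.asp .pos × A.den .pos) × Z)) ((Δ.asp .neg × A.den .neg) × W)) :
    Cont (U × ((Δ.insert a A).asp .pos × Z)) ((Δ.insert a A).asp .neg × W) :=
  ⟨fun w =>
    let r := P (w.1, ((Ctx.tail (fun A : CType => A.den .pos) ha w.2.1,
      Ctx.head (fun A : CType => A.den .pos) (Δ := Δ) w.2.1), w.2.2))
    (Ctx.extend (fun A : CType => A.den .neg) r.1, r.2), by fun_prop⟩

def assocR {X Y Z W B D : Type} [CompletePartialOrder X] [CompletePartialOrder Y]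
    [CompletePartialOrder Z] [CompletePartialOrder W] [CompletePartialOrder B]
    [CompletePartialOrder D] (P : Cont (U × ((X × B) × Z)) ((Y × D) × W)) :
    Cont (U × (X × (B × Z))) (Y × (D × W)) :=
  ⟨fun w =>
    let r := P (w.1, ((w.2.1, w.2.2.1), w.2.2.2))
    (r.1.1, (r.1.2, r.2)), by fun_prop⟩

def assocL {X Y Z W B D : Type} [CompletePartialOrder X] [CompletePartialOrder Y]
    [CompletePartialOrder Z] [CompletePartialOrder W] [CompletePartialOrder B]
    [CompletePartialOrder D] (P : Cont (U × (X × (B × Z))) (Y × (D × W))) :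
    Cont (U × ((X × B) × Z)) ((Y × D) × W) :=
  ⟨fun w =>
    let r := P (w.1, (w.2.1.1, (w.2.1.2, w.2.2)))
    ((r.1, r.2.1), r.2.2), by fun_prop⟩

/-- Presents a process that uses `Δ₁, Δ₂` as one that uses the union of `Δ₁` and `Δ₂`. -/
def mkU (h : Disjoint Δ₁.dom Δ₂.dom)
    (P : Cont (U × ((Δ₁.asp .pos × Δ₂.asp .pos) × Z)) ((Δ₁.asp .neg × Δ₂.asp .neg) × W)) :
    Cont (U × ((Δ₁.union Δ₂).asp .pos × Z)) ((Δ₁.union Δ₂).asp .neg × W) :=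
  ⟨fun w =>
    let r := P (w.1, (Ctx.fork (fun A : CType => A.den .pos) h w.2.1, w.2.2))
    (Ctx.join (fun A : CType => A.den .neg) r.1, r.2), by fun_prop⟩

end Plumbing

/-- The extended environment `[u | x ↦ v]`. -/
def bind {Ψ : Ctx FType} {t : FType} (x : Name) : Cont (Ψ.fenv × t.den) (Ψ.insert x t).fenv :=
  Ctx.extend FType.den

/-- Precomposition with `bind`, in the presence of a further argument. -/
def binding {Ψ : Ctx FType} {t : FType} (x : Name) {X Y : Type} [CompletePartialOrder X]
    [CompletePartialOrder Y] (P : Cont ((Ψ.insert x t).fenv × X) Y) :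
    Cont ((Ψ.fenv × t.den) × X) Y :=
  ⟨fun w => P (bind x w.1, w.2), by fun_prop⟩

mutual

/-- The denotation of a functional term, a continuous function of the functional variables. -/
def Term.sem : {Ψ : Ctx FType} → {t : FType} → Term Ψ t → Cont Ψ.fenv t.den
  | _, _, .var x => ⟨fun u => u x, by fun_prop⟩
  | _, _, .fix x M => sfix (M.sem.comp (bind x))
  | _, _, .lam x _ M => semLam (M.sem.comp (bind x))
  | _, _, .app M N => semApp M.sem N.sem
  | _, _, .quote P => up.comp P.sem.curry

/-- The denotation of a process, in uncurried form. -/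
def Proc.sem : {Ψ : Ctx FType} → {Δ : Ctx CType} → {c : Name} → {C : CType} → Proc Ψ Δ c C →
    USem Ψ.fenv Δ C
  | _, _, _, _, .fwd _ _ _ _ => mkl (Δ := Ctx.nil) (Finset.notMem_empty _) semFwd
  | _, _, _, _, .cut _ _ h ha _ P Q => mkU h (semCut P.sem (unl ha Q.sem))
  | _, _, _, _, .close _ => semClose
  | _, _, _, _, .wait _ ha _ P => mkl ha (semWait P.sem)
  | _, _, _, _, .downR P => semDownR P.sem
  | _, _, _, _, .downL _ _ ha P => mkl ha (semDownL (unl ha P.sem))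
  | _, _, _, _, .upR P => semUpR P.sem
  | _, _, _, _, .upL _ _ ha P => mkl ha (semUpL (unl ha P.sem))
  | _, _, _, _, .plusR _ k P => semPlusR k P.sem
  | _, _, _, _, .plusL _ _ ha _ _ P => mkl ha (semPlusL fun l => unl ha (P l).sem)
  | _, _, _, _, .ampR _ _ P => semAmpR fun l => (P l).sem
  | _, _, _, _, .ampL _ _ k ha P => mkl ha (semAmpL k (unl ha P.sem))
  | _, _, _, _, .tensorR _ _ hb _ P => mkl hb (semTensorR P.sem)
  | _, _, _, _, .tensorL _ _ _ _ ha hb P =>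
    mkl ha (semTensorL (assocL (unl ha (assocR (unl hb P.sem)))))
  | _, _, _, _, .lollyR _ _ hb P => semLollyR (unl hb P.sem)
  | _, _, _, _, .lollyL _ _ _ _ hb _ ha ha' P =>
    mkl ha (assocL (mkl hb (assocR (semLollyL (unl ha' P.sem)))))
  | _, _, _, _, .andR M P => semAndR M.sem P.sem
  | _, _, _, _, .andL _ x _ _ ha P => mkl ha (semAndL (unl ha (binding x P.sem)))
  | _, _, _, _, .impR x _ P => semImpR (binding x P.sem)
  | _, _, _, _, .impL _ _ ha M P => mkl ha (semImpL M.sem (unl ha P.sem))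
  | _, _, _, _, .muR A P => semR (unfoldFn A .neg) (foldFn A .pos) P.sem
  | _, _, _, _, .muL _ A ha P => mkl ha (semL (unfoldFn A .pos) (foldFn A .neg) (unl ha P.sem))
  | _, Δ, _, C, .unquote _ M =>
    let f : Cont _ (PDom Δ C) := down.comp M.sem
    ⟨fun w => f w.1 w.2, by fun_prop⟩

end

/-- The denotation `⟦Ψ ; Δ ⊢ P :: c : C⟧ : ⟦Ψ⟧ → [⟦Δ⟧⁺ × ⟦c : C⟧⁻ → ⟦Δ⟧⁻ × ⟦c : C⟧⁺]`. -/
def Proc.den {Ψ : Ctx FType} {Δ : Ctx CType} {c : Name} {C : CType} (P : Proc Ψ Δ c C) :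
    Cont Ψ.fenv (PDom Δ C) := P.sem.curry

/-- Denotational equivalence `P ≡ Q` of processes. -/
def Proc.Equiv {Ψ : Ctx FType} {Δ : Ctx CType} {c : Name} {C : CType} (P Q : Proc Ψ Δ c C) :
    Prop := P.den = Q.den

end

end SILL

-- Sending `k` and then branching on it transmits the data of `P` and `Q k` through an encoding: a
-- negative value `x` becomes the tuple `only k x`, a positive value `y` becomes the message `inj k
-- (up y)`. The sender decodes the tuple by reading its `k`-th component, and `only_self` says that
-- this recovers `x`. The receiver decodes the message by case analysis, and `semPlusL_inj` says
-- that this recovers `y` and enters branch `k`. So the two feedback loops perform the same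
-- exchange, and only their least solutions have to be compared.
--
-- The encoding is not strict, because `up ⊥` is not `⊥`; hence it does not carry one sequence of
-- Kleene iterates to the other, and the comparison uses two inequalities between least fixed points
-- instead. On one side, the encoding of the least solution for `P` and `Q k` solves the loop with
-- the label, so it lies above the least solution there. On the other side, the sender emits the
-- label whatever it has received, so every solution of the loop with the label has a positive part
-- of the form `inj k (up y)`; branch `k` then forces the negative part to be an `only k` tuple.
-- Such a solution is an encoding, and what it encodes solves the loop of `P` and `Q k`, so it lies
-- above the encoding of the least solution of that loop. This is `sfix_cutStep_plus`, which rests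
-- on `sfix_le` and `map_sfix`; `semCut_plus` draws the consequence for compositions.
--
-- What remains is bookkeeping with contexts. The case analysis adjoins the channel `a` to its
-- context and the composition separates it again; `unl_mkl` says that the two operations cancel.

namespace SILL

-- Parametrized least fixed points.

section LeastFixedPoints

variable {A D : Type} [CompletePartialOrder A] [CompletePartialOrder D]

theorem iter_monotone (f : Cont (A × D) D) : Monotone (iter f) := by
  refine monotone_nat_of_le_succ fun n => ?_
  induction n with
  | zero => exact bot_le
  | succ n ih => exact fun a => f.mono ⟨le_rfl, ih a⟩

/-- In a pointed dcpo, `⨆` is a genuine supremum only over directed families; the iterates form a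
chain, so the definition of `sfix` has its intended meaning. -/
theorem isLUB_sfix (f : Cont (A × D) D) : IsLUB (Set.range (iter f)) (sfix f) :=
  (iter_monotone f).directed_le.directedOn_range.isLUB_sSup

theorem isLUB_sfix_apply (f : Cont (A × D) D) (a : A) :
    IsLUB (Set.range fun n => iter f n a) (sfix f a) := by
  have h := Cont.isLUB_apply (iter_monotone f).directed_le.directedOn_range (isLUB_sfix f) a
  rwa [← Set.range_comp] at h

/-- Park induction: a prefixed point bounds every iterate, by induction from `⊥`, and hence bounds
their supremum. Both inequalities between the feedback loops are instances of it. -/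
theorem sfix_le (f : Cont (A × D) D) {a : A} {x : D} (h : f (a, x) ≤ x) : sfix f a ≤ x := by
  refine (isLUB_sfix_apply f a).2 ?_
  rintro _ ⟨n, rfl⟩
  dsimp only
  induction n with
  | zero => exact bot_le (α := D)
  | succ n ih => exact (f.mono (show (a, iter f n a) ≤ (a, x) from ⟨le_rfl, ih⟩)).trans h

/-- Kleene's theorem: by continuity the left side is the supremum of the values of `f` at the
iterates, and these values are again iterates, shifted by one. -/
theorem map_sfix (f : Cont (A × D) D) (a : A) : f (a, sfix f a) = sfix f a := by
  have hm : Monotone fun n => iter f n a := fun _ _ h => iter_monotone f h a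
  have hc : ScottContinuous fun x => f (a, x) := by fun_prop
  have h := hc (Set.range_nonempty _) hm.directed_le.directedOn_range (isLUB_sfix_apply f a)
  rw [← Set.range_comp] at h
  -- The first bound says that the supremum is a prefixed point. Applying `f` to it shows that `f
  -- (a, sfix f a)` is one too, so the reverse bound is Park induction.
  refine le_antisymm (h.2 ?_) (sfix_le f (f.mono ⟨le_rfl, h.2 ?_⟩))
  · rintro _ ⟨n, rfl⟩
    exact (isLUB_sfix_apply f a).1 ⟨n + 1, rfl⟩
  · rintro _ ⟨n, rfl⟩
    exact (isLUB_sfix_apply f a).1 ⟨n + 1, rfl⟩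

end LeastFixedPoints

-- Adjoining a channel to a context and separating it again.

namespace Ctx

variable {T : Type} (E : T → Dom) {Δ : Ctx T} {a : Name} {A : T}

/-- The type of a declaration in `insert` is computed by a case distinction, so it equals the
expected type only propositionally and components are transported. Successive transports compose,
and by `castE_rfl` a round trip is trivial, whatever equality proof it uses. -/
theorem castE_castE {A B C : T} (h : A = B) (h' : B = C) (x : E A) :
    castE E h' (castE E h x) = castE E (h.trans h') x := by
  subst h h'
  rfl

theorem castE_rfl (h : A = A) (x : E A) : castE E h x = x := rfl

theorem head_extend (w : Δ.env E × E A) : head E (Δ := Δ) (a := a) (extend E w) = w.2 := by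
  change castE E _ (dite _ _ _) = _
  rw [dif_pos rfl, castE_castE, castE_rfl]

theorem tail_extend (ha : a ∉ Δ.dom) (w : Δ.env E × E A) : tail E ha (extend E w) = w.1 := by
  funext x
  change castE E _ (dite _ _ _) = _
  rw [dif_neg fun h : x.1 = a => ha (h ▸ x.2), castE_castE, castE_rfl]

end Ctx

/-- Both maps only repackage tuples: positive aspects on the way in, negative aspects on the way
out. In each direction a pair is extended by `a` and split again, which changes nothing since `a` is
fresh for `Δ`. -/
theorem unl_mkl {U Z W : Type} [CompletePartialOrder U] [CompletePartialOrder Z]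
    [CompletePartialOrder W] {Δ : Ctx CType} {a : Name} {A : CType} (ha : a ∉ Δ.dom)
    (P : Cont (U × ((Δ.asp .pos × A.den .pos) × Z)) ((Δ.asp .neg × A.den .neg) × W)) :
    unl ha (mkl ha P) = P := by
  have key (w : (Δ.asp .pos × A.den .pos)) (v : Δ.asp .neg × A.den .neg) :
      (Ctx.tail (fun A : CType => A.den .pos) ha (Ctx.extend (a := a) _ w),
        Ctx.head (fun A : CType => A.den .pos) (Δ := Δ) (a := a) (Ctx.extend _ w)) = w ∧
      (Ctx.tail (fun A : CType => A.den .neg) ha (Ctx.extend (a := a) _ v),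
        Ctx.head (fun A : CType => A.den .neg) (Δ := Δ) (a := a) (Ctx.extend _ v)) = v :=
    ⟨Prod.ext (Ctx.tail_extend _ ha w) (Ctx.head_extend _ w),
      Prod.ext (Ctx.tail_extend _ ha v) (Ctx.head_extend _ v)⟩
  ext w : 1
  exact (congrArg₂ Prod.mk (key w.2.1 _).2 rfl).trans
    -- Only the positive half of `key` is needed for the argument of `P`, so `⊥` is a dummy negative
    -- value.
    (congrArg (fun x => P (w.1, (x, w.2.2))) (key w.2.1 ⊥).1)

-- Composition through a transmitted label.

section Cut

variable {U X₁ Y₁ X₂ Y₂ Z W L : Type} [CompletePartialOrder U] [CompletePartialOrder X₁]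
  [CompletePartialOrder Y₁] [CompletePartialOrder X₂] [CompletePartialOrder Y₂]
  [CompletePartialOrder Z] [CompletePartialOrder W] {Fn Fp : L → Type}
  [∀ l, CompletePartialOrder (Fn l)] [∀ l, CompletePartialOrder (Fp l)]

@[simp] theorem only_self (k : L) (x : Fn k) : only (Fn := Fn) k x k = x := dif_pos rfl

theorem semPlusR_apply (k : L) (P : Cont (U × (X₁ × Fn k)) (Y₁ × Fp k)) (u : U) (x : X₁)
    (y : ∀ l, Fn l) :
    semPlusR k P (u, (x, y)) =
      ((P (u, (x, y k))).1, inj (F := fun l => Lift (Fp l)) k (up (P (u, (x, y k))).2)) := rfl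

/-- The lifting is essential: `up y` differs from `⊥` even for `y = ⊥`, so the coalesced sum retains
the label and the case analysis always enters branch `k`. -/
theorem semPlusL_inj (Q : ∀ l, Cont (U × ((X₂ × Fp l) × Z)) ((Y₂ × Fn l) × W)) (u : U) (x : X₂)
    (k : L) (y : Fp k) (z : Z) :
    semPlusL Q (u, ((x, inj (F := fun l => Lift (Fp l)) k (up y)), z)) =
      (((Q k (u, ((x, y), z))).1.1, only k (Q k (u, ((x, y), z))).1.2),
        (Q k (u, ((x, y), z))).2) :=
  sumCase_inj (F := fun l => Lift (Fp l)) (fun l => ⟨fun w : (U × (X₂ × Z)) × Lift (Fp l) =>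
    (((Q l (w.1.1, ((w.1.2.1, down w.2), w.1.2.2))).1.1,
      only l (Q l (w.1.1, ((w.1.2.1, down w.2), w.1.2.2))).1.2),
      (Q l (w.1.1, ((w.1.2.1, down w.2), w.1.2.2))).2), by fun_prop⟩) (u, (x, z)) (up_ne_bot y)

/-- The feedback map of a composition. -/
noncomputable def cutStep {An Ap : Type} [CompletePartialOrder An] [CompletePartialOrder Ap]
    (P : Cont (U × (X₁ × An)) (Y₁ × Ap)) (Q : Cont (U × ((X₂ × Ap) × Z)) ((Y₂ × An) × W)) :
    Cont ((U × ((X₁ × X₂) × Z)) × (An × Ap)) (An × Ap) :=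
  ⟨fun w => ((Q (w.1.1, ((w.1.2.1.2, w.2.2), w.1.2.2))).1.2, (P (w.1.1, (w.1.2.1.1, w.2.1))).2),
    by fun_prop⟩

/-- The trace in `semCut` iterates exactly `cutStep P Q`. This exposes the fixed point, so that
compositions can be compared through their feedback maps. -/
theorem semCut_apply {An Ap : Type} [CompletePartialOrder An] [CompletePartialOrder Ap]
    (P : Cont (U × (X₁ × An)) (Y₁ × Ap)) (Q : Cont (U × ((X₂ × Ap) × Z)) ((Y₂ × An) × W))
    (w : U × ((X₁ × X₂) × Z)) :
    semCut P Q w =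
      (((P (w.1, (w.2.1.1, (sfix (cutStep P Q) w).1))).1,
        (Q (w.1, ((w.2.1.2, (sfix (cutStep P Q) w).2), w.2.2))).1.1),
        (Q (w.1, ((w.2.1.2, (sfix (cutStep P Q) w).2), w.2.2))).2) := rfl

/-- The least solution for a transmitted choice is the image of the one for the chosen branch. -/
theorem sfix_cutStep_plus (k : L) (P : Cont (U × (X₁ × Fn k)) (Y₁ × Fp k))
    (Q : ∀ l, Cont (U × ((X₂ × Fp l) × Z)) ((Y₂ × Fn l) × W)) (w : U × ((X₁ × X₂) × Z)) :
    sfix (cutStep (semPlusR k P) (semPlusL Q)) w =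
      (only k (sfix (cutStep P (Q k)) w).1,
        inj (F := fun l => Lift (Fp l)) k (up (sfix (cutStep P (Q k)) w).2)) := by
  -- The tuple `x` is arbitrary rather than of the form `only k _`, since the sender reads only `x
  -- k`. This generality allows `step` to be applied below to a solution whose negative part is not
  -- yet known to be such a tuple.
  have step (x : ∀ l, Fn l) (y : Fp k) :
      cutStep (semPlusR k P) (semPlusL Q) (w, (x, inj (F := fun l => Lift (Fp l)) k (up y))) =
        (only k (cutStep P (Q k) (w, (x k, y))).1,
          inj (F := fun l => Lift (Fp l)) k (up (cutStep P (Q k) (w, (x k, y))).2)) := by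
    refine Prod.ext ?_ rfl
    exact congrArg (fun r => r.1.2) (semPlusL_inj Q w.1 w.2.1.2 k y w.2.2)
  apply le_antisymm
  · refine sfix_le _ (le_of_eq ?_)
    rw [step, only_self, Prod.mk.eta, map_sfix]
  · set s := sfix (cutStep (semPlusR k P) (semPlusL Q)) w with hs
    have hfix : cutStep (semPlusR k P) (semPlusL Q) (w, s) = s := map_sfix _ w
    -- This is the value that `P` sends in the least solution `s`. The second fixed point equation
    -- then gives the shape of `s.2`, because the label is sent unconditionally.
    set y := (P (w.1, (w.2.1.1, s.1 k))).2 with hy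
    have hs₂ : s.2 = inj (F := fun l => Lift (Fp l)) k (up y) := (congrArg Prod.snd hfix).symm
    have hs₁ : s.1 = only k (cutStep P (Q k) (w, (s.1 k, y))).1 := by
      have h := step s.1 y
      rw [← hs₂, Prod.mk.eta, hfix] at h
      exact congrArg Prod.fst h
    have hk : (cutStep P (Q k) (w, (s.1 k, y))).1 = s.1 k := by
      conv_rhs => rw [hs₁, only_self]
    -- The decoded pair solves the loop of `P` and `Q k`: `hk` is its negative equation, and the
    -- positive one is the definition of `y`.
    have hle : sfix (cutStep P (Q k)) w ≤ (s.1 k, y) := sfix_le _ (le_of_eq (Prod.ext hk rfl))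
    have hle₁ := (only k).mono hle.1
    have hle₂ := (inj (F := fun l => Lift (Fp l)) k).mono (up.mono hle.2)
    -- Now `s.1` is itself the encoding of `s.1 k`, so monotonicity of the encoding finishes the
    -- comparison.
    rw [hk] at hs₁
    exact ⟨hle₁.trans hs₁.ge, hle₂.trans hs₂.ge⟩

/-- At corresponding least solutions, `P` and `Q k` receive the same inputs on both sides, and the
encoding affects only the internal channel, so the external outputs agree. -/
theorem semCut_plus (k : L) (P : Cont (U × (X₁ × Fn k)) (Y₁ × Fp k))
    (Q : ∀ l, Cont (U × ((X₂ × Fp l) × Z)) ((Y₂ × Fn l) × W)) :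
    semCut (semPlusR k P) (semPlusL Q) = semCut P (Q k) := by
  ext w : 1
  rw [semCut_apply, semCut_apply, sfix_cutStep_plus, semPlusL_inj, semPlusR_apply]
  simp only [only_self]

end Cut

end SILL

-- The equivalence for typed processes.

theorem mainTheorem5 {Ψ : SILL.Ctx SILL.FType} {Δ₁ Δ₂ : SILL.Ctx SILL.CType} {a c : SILL.Name}
    {C : SILL.CType} {L : Finset SILL.Label} (A : L → SILL.SType [] .pos) (k : L)
    (hΔ : Disjoint Δ₁.dom Δ₂.dom) (ha : a ∉ Δ₂.dom) (hac : a ≠ c) (hc₁ : c ∉ Δ₁.dom)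
    (hc₂ : c ∉ Δ₂.dom) (P : SILL.Proc Ψ Δ₁ a ⟨.pos, A k⟩)
    (Q : ∀ l : L, SILL.Proc Ψ (Δ₂.insert a ⟨.pos, A l⟩) c C) :
    SILL.Proc.Equiv (.cut a ⟨.pos, A k⟩ hΔ ha hc₁ P (Q k))
      (.cut a ⟨.pos, .plus L A⟩ hΔ ha hc₁ (.plusR A k P) (.plusL a A ha hac hc₂ Q)) := by
  refine congrArg SILL.Cont.curry ?_
  -- The aspects of the internal choice unfold definitionally to the product and the coalesced sum
  -- of liftings, so the clause `semPlusL` fits here without any transport.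
  have h := SILL.unl_mkl (A := ⟨.pos, .plus L A⟩) ha
    (SILL.semPlusL fun l => SILL.unl ha (Q l).sem)
  refine congrArg (SILL.mkU hΔ) (Eq.trans ?_
    (congrArg (SILL.semCut (SILL.Proc.plusR A k P).sem) h.symm))
  exact (SILL.semCut_plus k P.sem fun l => SILL.unl ha (Q l).sem).symm
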